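/- **Setting.** $\|\cdot\|$ is the Euclidean norm on $\mathbb R^n$, $\lambda_{\min}(H)$ the left-most eigenvalue of a symmetric matrix $H$; $g=\nabla f$, $H=\nabla^2 f$, and $g_k,H_k$ are their values at $x_k$. A function $f:\mathbb R^n\to\mathbb R$ satisfies **A.1** with constants $L_g,L_H$ if it is $C^2$, bounded below, $\|g(x)-g(y)\|\le L_g\|x-y\|$ and $\|H(x)-H(y)\|\le L_H\|x-y\|$ for all $x,y$. **Royer–Wright (RW) algorithm**, with parameters $\eta>0$, $\theta\in(0,1)$, $\epsilon_g\in(0,1)$, $\epsilon_H>0$. At $x_k$, if $g_k\ne0$ let $R_k=g_k^TH_kg_k/\|g_k\|^2$. If $g_k\neq 0$ and $R_k<-\epsilon_H$, take $d_k=(R_k/\|g_k\|)g_k$. If $|R_k|\le\epsilon_H$ and $\|g_k\|>\epsilon_g$, take $d_k=-g_k/\|g_k\|^{1/2}$. In all other cases compute $\lambda_k=\lambda_{\min}(H_k)$ and: terminate if $\|g_k\|\le\epsilon_g$ and $\lambda_k\ge-\epsilon_H$; otherwise, if $\lambda_k<-\epsilon_H$ take for $d_k$ an eigenvector for $\lambda_k$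 with $\|d_k\|=|\lambda_k|$ and $d_k^Tg_k\le0$; if $\lambda_k>\epsilon_H$ take the Newton direction $H_kd_k=-g_k$; if $|\lambda_k|\le\epsilon_H$ solve $(H_k+2\epsilon_HI)d_k=-g_k$. Then $x_{k+1}=x_k+\alpha_kd_k$, where $\alpha_k$ is the first of $1,\theta,\theta^2,\dots$ with $f(x_k+\alpha_kd_k)\le f(x_k)-\frac\eta6\alpha_k^3\|d_k\|^3$. **Class M.1**, with constants $\kappa_{rg}\in[0,1)$, $\kappa_{rs}>0$, $\kappa_\lambda>1$, $\kappa_s>0$: methods that compute $s_k=x_{k+1}-x_k\neq0$ from $x_i,f(x_i),g_i,H_i$ ($i\le k$), such that, until termination, $\|s_k\|\le\kappa_s$ and, for some symmetric $M_k$ and some $r_k$: $M_k\succeq0$, $H_k+M_k\succeq0$, $(H_k+M_k)s_k=-g_k+r_k$, $\|r_k\|\le\min[\kappa_{rg}\|g_k\|,\kappa_{rs}\|M_ks_k\|]$, and $\lambda_{\min}(H_k)+\lambda_{\min}(M_k)\le\kappa_\lambda\max\{|\lambda_{\min}(H_k)|,\|g_k\|^{1/2}\}$. **CRS class** (Curtis–Robinson–Samadi),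 with parameters $\bar\sigma>0$, $\bar\eta\in(0,1)$, $\kappa_1,\kappa_2\ge0$: start with $\sigma^L_0=0$, $\sigma^U_0=\bar\sigma$; at iteration $k$ choose $s_k$, $\lambda_k\ge0$, $r_k$ with $(H_k+\lambda_kI)s_k=-g_k+r_k$, $\sigma^L_k\|s_k\|\le\lambda_k\le\sigma^U_k\|s_k\|$, $s_k^Tr_k\le\frac12s_k^T(H_k+\lambda_kI)s_k+\frac12\kappa_1\|s_k\|^3$, $\|r_k\|\le\lambda_k\|s_k\|+\kappa_2\|s_k\|^2$. If $f(x_k)-f(x_k+s_k)\ge\bar\eta\|s_k\|^3$, then $x_{k+1}=x_k+s_k$, $\sigma^L_{k+1}=0$, $\sigma^U_{k+1}=\bar\sigma$; otherwise $x_{k+1}=x_k$ and $\sigma^L,\sigma^U$ are updated in any way. **Theorem.** Let $\eta\in(0,3]$ and $\theta\in(0,1)$. 1. *(Slow example.)* There are constants $L,a,b$ such that for all $\epsilon_g\in(0,1)$ and $0<\epsilon_H\le\sqrt{\epsilon_g}$ there is $f:\mathbb R\to[a,b]$ satisfying A.1 with $L_g=L_H=L$, for which the RW algorithm started at $x_0=0$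 has exactly one execution; it takes the Newton direction with $\alpha_k=1$ at every iteration and terminates exactly at iteration $k_{\epsilon_g}=\lceil\epsilon_g^{-3/2}\rceil$, and $x_{k_{\epsilon_g}}$ is its first iterate with $\|\nabla f(x_k)\|\le\epsilon_g$. 2. *(Sharpness.)* The order $\epsilon_g^{-3/2}$ is also an upper bound: for every $L_H\ge0$ and $c\in(0,1]$ there is $C>0$ such that for all $\epsilon_g\in(0,1)$, all $\epsilon_H\in[c\sqrt{\epsilon_g},\sqrt{\epsilon_g}]$, all $n$, all $f:\mathbb R^n\to\mathbb R$ satisfying A.1 with Hessian constant $L_H$ (and any $L_g$), every lower bound $f_{\rm low}$ of $f$ and every $x_0$: each iteration of the RW algorithm that does not terminate is well defined (a direction exists and, for every direction that may be selected, the linesearch is finite), and every execution, as long as all iterates before the current one have gradient norm larger than $\epsilon_g$, has used at most $C\big((f(x_0)-f_{\rm low})\,\epsilon_g^{-3/2}+1\big)$ evaluations of $f$, linesearch trials included. 3. *(Optimality with respect to M.1.)* For all $\kappa_{rg}\in[0,1)$, $\kappa_{rs}>0$, $\kappa_\lambda>1$ there are $L,a,b$ such that for every $\epsilon\in(0,1)$,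 $\kappa_s>0$ and every method which, on all $f:\mathbb R\to[a,b]$ satisfying A.1 with $L_g=L_H=L$ and from $x_0=0$, obeys the requirements of M.1 until an iterate with $|g_k|\le\epsilon$ is found, there is such an $f$ on which $|g_k|>\epsilon$ for all $k<\lceil\epsilon^{-3/2}\rceil$. 4. *(Optimality with respect to CRS.)* For all parameters $\bar\sigma,\bar\eta,\kappa_1,\kappa_2$ as above there are $L,a,b$ and $c>0$ such that for every $\epsilon\in(0,1)$ there is $f:\mathbb R\to[a,b]$ satisfying A.1 with $L_g=L_H=L$ such that, in every execution of a CRS method with these parameters from $x_0=0$, $|g_N|\le\epsilon$ implies $N\ge c\,\epsilon^{-3/2}$. Thus the first-order worst-case evaluation complexity of the RW algorithm is exactly of order $\epsilon_g^{-3/2}$, and no method in M.1 or CRS has a worst-case complexity of better order. -/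

import Mathlib

/-- `ℝⁿ` with the Euclidean norm. -/
abbrev Eu (n : ℕ) : Type := EuclideanSpace ℝ (Fin n)

/-- The Hessian of `f` at `x`, as the (self-adjoint, when `f` is `C²`) operator `v ↦ ∇²f(x) v`. -/
noncomputable def hess {n : ℕ} (f : Eu n → ℝ) (x : Eu n) : Eu n →L[ℝ] Eu n :=
  fderiv ℝ (gradient f) x

/-- The left-most (real) eigenvalue of an operator on `ℝⁿ`; only used for symmetric operators. -/
noncomputable def lamMin {n : ℕ} (H : Eu n →L[ℝ] Eu n) : ℝ :=
  sInf {μ : ℝ | Module.End.HasEigenvalue (H : Eu n →ₗ[ℝ] Eu n) μ}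

/-- Assumption A.1 with Lipschitz constants `Lg` (gradient) and `LH` (Hessian). -/
structure A1 {n : ℕ} (Lg LH : ℝ) (f : Eu n → ℝ) : Prop where
  contDiff : ContDiff ℝ 2 f
  bddBelow : BddBelow (Set.range f)
  lip_grad : ∀ x y, ‖gradient f x - gradient f y‖ ≤ Lg * ‖x - y‖
  lip_hess : ∀ x y, ‖hess f x - hess f y‖ ≤ LH * ‖x - y‖

/-! ### The Royer-Wright linesearch algorithm -/

section RW

variable {n : ℕ}

/-- Curvature of `f` at `x` along the gradient, `gᵀ H g / ‖g‖²` (used only where `g ≠ 0`). -/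
noncomputable def gradCurv (f : Eu n → ℝ) (x : Eu n) : ℝ :=
  inner ℝ (gradient f x) (hess f x (gradient f x)) / ‖gradient f x‖ ^ 2

/-- Strong negative curvature along the gradient: `d = (R / ‖g‖) g`. -/
def RWNegGrad (f : Eu n → ℝ) (εH : ℝ) (x d : Eu n) : Prop :=
  gradient f x ≠ 0 ∧ gradCurv f x < -εH ∧
    d = (gradCurv f x / ‖gradient f x‖) • gradient f x

/-- Small curvature along a large gradient: `d = - g / ‖g‖^(1/2)`. -/
def RWGrad (f : Eu n → ℝ) (εg εH : ℝ) (x d : Eu n) : Prop :=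
  gradient f x ≠ 0 ∧ gradCurv f x ∈ Set.Icc (-εH) εH ∧ εg < ‖gradient f x‖ ∧
    d = -((Real.sqrt ‖gradient f x‖)⁻¹ • gradient f x)

/-- Neither of the two gradient-type directions is selected, so that the algorithm computes the
left-most eigenpair of the Hessian. -/
def RWSecondOrder (f : Eu n → ℝ) (εg εH : ℝ) (x : Eu n) : Prop :=
  gradient f x = 0 ∨
    (¬ gradCurv f x < -εH ∧ ¬ (gradCurv f x ∈ Set.Icc (-εH) εH ∧ εg < ‖gradient f x‖))

/-- The algorithm stops at `x`. -/
def RWStops (f : Eu n → ℝ) (εg εH : ℝ) (x : Eu n) : Prop :=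
  RWSecondOrder f εg εH x ∧ ‖gradient f x‖ ≤ εg ∧ -εH ≤ lamMin (hess f x)

/-- Negative curvature direction: a left-most eigenvector, of norm `-λ_min`. -/
def RWNegCurv (f : Eu n → ℝ) (εg εH : ℝ) (x d : Eu n) : Prop :=
  RWSecondOrder f εg εH x ∧ lamMin (hess f x) < -εH ∧
    hess f x d = lamMin (hess f x) • d ∧ inner ℝ d (gradient f x) ≤ 0 ∧
    ‖d‖ = max (-lamMin (hess f x)) 0

/-- Newton direction. -/
def RWNewton (f : Eu n → ℝ) (εg εH : ℝ) (x d : Eu n) : Prop :=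
  RWSecondOrder f εg εH x ∧ ¬ RWStops f εg εH x ∧ εH < lamMin (hess f x) ∧
    hess f x d = -gradient f x

/-- Regularized Newton direction. -/
def RWRegNewton (f : Eu n → ℝ) (εg εH : ℝ) (x d : Eu n) : Prop :=
  RWSecondOrder f εg εH x ∧ ¬ RWStops f εg εH x ∧
    lamMin (hess f x) ∈ Set.Icc (-εH) εH ∧
    hess f x d + (2 * εH) • d = -gradient f x

/-- `d` is a search direction that the algorithm may select at `x`. -/
def RWDirection (f : Eu n → ℝ) (εg εH : ℝ) (x d : Eu n) : Prop :=
  RWNegGrad f εH x d ∨ RWGrad f εg εH x d ∨ RWNegCurv f εg εH x d ∨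
    RWNewton f εg εH x d ∨ RWRegNewton f εg εH x d

/-- Backtracking from the unit steplength: `j` is the first exponent for which the steplength
`θ ^ j` gives the required cubic decrease. -/
def RWLineSearch (f : Eu n → ℝ) (η θ : ℝ) (x d : Eu n) (j : ℕ) : Prop :=
  IsLeast {i : ℕ | f (x + θ ^ i • d) ≤ f x - η / 6 * (θ ^ i) ^ 3 * ‖d‖ ^ 3} j

/-- `x 0, …, x N` are the first iterates of an execution of the algorithm started at `x₀`, with
search directions `d k` and steplengths `θ ^ (j k)` for `k < N`. -/
structure RWRun (f : Eu n → ℝ) (η θ εg εH : ℝ) (x₀ : Eu n) (N : ℕ)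
    (x d : ℕ → Eu n) (j : ℕ → ℕ) : Prop where
  start : x 0 = x₀
  direction : ∀ k < N, RWDirection f εg εH (x k) (d k)
  search : ∀ k < N, RWLineSearch f η θ (x k) (d k) (j k)
  next : ∀ k < N, x (k + 1) = x k + θ ^ j k • d k

/-- Number of evaluations of `f` in the first `N` iterations: one at the starting point and, in
each iteration, one per trial steplength. (Gradient and Hessian are evaluated once per iterate.) -/
def rwEvals (N : ℕ) (j : ℕ → ℕ) : ℕ := 1 + ∑ k ∈ Finset.range N, (j k + 1)

end RW

/-! ### The class M.1 -/

/-- What one evaluation returns: a point with the value, gradient and Hessian of `f` there. -/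
structure Answer (n : ℕ) where
  point : Eu n
  value : ℝ
  grad : Eu n
  hessian : Eu n →L[ℝ] Eu n

noncomputable def answer {n : ℕ} (f : Eu n → ℝ) (x : Eu n) : Answer n :=
  ⟨x, f x, gradient f x, hess f x⟩

/-- A method: it computes the next step from all evaluations made so far (latest one first). -/
abbrev StepRule (n : ℕ) : Type := List (Answer n) → Eu n

/-- Current iterate and list of past evaluations. -/
noncomputable def StepRule.state {n : ℕ} (A : StepRule n) (f : Eu n → ℝ) (x₀ : Eu n) :
    ℕ → Eu n × List (Answer n)
  | 0 => (x₀, [answer f x₀])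
  | k + 1 =>
      let p := StepRule.state A f x₀ k
      (p.1 + A p.2, answer f (p.1 + A p.2) :: p.2)

/-- The iterates of the method `A` applied to `f` from `x₀`. -/
noncomputable def StepRule.iterate {n : ℕ} (A : StepRule n) (f : Eu n → ℝ) (x₀ : Eu n)
    (k : ℕ) : Eu n := (StepRule.state A f x₀ k).1

/-- The requirements of the class M.1 on a step `s` at a point with gradient `g` and Hessian `H`. -/
def M1Step {n : ℕ} (κrg κrs κl κs : ℝ) (g : Eu n) (H : Eu n →L[ℝ] Eu n) (s : Eu n) : Prop :=
  s ≠ 0 ∧ ‖s‖ ≤ κs ∧ ∃ (M : Eu n →L[ℝ] Eu n) (r : Eu n),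
    M.IsPositive ∧ (H + M).IsPositive ∧ (H + M) s = -g + r ∧
    ‖r‖ ≤ min (κrg * ‖g‖) (κrs * ‖M s‖) ∧
    lamMin H + lamMin M ≤ κl * max |lamMin H| (Real.sqrt ‖g‖)

/-- Applied to `f` from `x₀`, the method takes steps as required in M.1 as long as no iterate with
gradient norm at most `ε` has been found. -/
def StepRule.IsM1On {n : ℕ} (A : StepRule n) (κrg κrs κl κs ε : ℝ) (f : Eu n → ℝ)
    (x₀ : Eu n) : Prop :=
  ∀ k : ℕ, (∀ i ≤ k, ε < ‖gradient f (A.iterate f x₀ i)‖) →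
    M1Step κrg κrs κl κs (gradient f (A.iterate f x₀ k)) (hess f (A.iterate f x₀ k))
      (A.iterate f x₀ (k + 1) - A.iterate f x₀ k)

/-! ### The Curtis-Robinson-Samadi class -/

/-- `x 0, …, x N` are the first iterates of an execution, started at `x₀`, of a CRS method with
parameters `σbar`, `η`, `κ₁`, `κ₂`; `s k`, `lam k`, `r k` are the (trial) steps, regularization
parameters and residuals, `σL k`, `σU k` the regularization thresholds. The update of the thresholds
after a rejected step is left free, so that every update mechanism is covered. -/
structure CRSRun {n : ℕ} (σbar η κ₁ κ₂ : ℝ) (f : Eu n → ℝ) (x₀ : Eu n) (N : ℕ)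
    (x s r : ℕ → Eu n) (lam σL σU : ℕ → ℝ) : Prop where
  start : x 0 = x₀
  start_lower : σL 0 = 0
  start_upper : σU 0 = σbar
  lam_nonneg : ∀ k < N, 0 ≤ lam k
  equation : ∀ k < N, hess f (x k) (s k) + lam k • s k = -gradient f (x k) + r k
  lam_bounds : ∀ k < N, σL k * ‖s k‖ ≤ lam k ∧ lam k ≤ σU k * ‖s k‖
  slope : ∀ k < N, inner ℝ (s k) (r k) ≤
    1 / 2 * inner ℝ (s k) (hess f (x k) (s k) + lam k • s k) + 1 / 2 * κ₁ * ‖s k‖ ^ 3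
  residual : ∀ k < N, ‖r k‖ ≤ lam k * ‖s k‖ + κ₂ * ‖s k‖ ^ 2
  accept : ∀ k < N, η * ‖s k‖ ^ 3 ≤ f (x k) - f (x k + s k) →
    x (k + 1) = x k + s k ∧ σL (k + 1) = 0 ∧ σU (k + 1) = σbar
  reject : ∀ k < N, ¬ η * ‖s k‖ ^ 3 ≤ f (x k) - f (x k + s k) → x (k + 1) = x k

/-! Everything happens at the scale `h = √ε`. A decrease of order `h³` per iteration can be repeated
only about `ε^(-3/2)` times on a bounded function. Conversely, a sine of amplitude of order 1 and
frequency of order `ε` has slope of order `ε` over a distance of order `1/ε`, which steps of length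
`h` need about `h⁻³` iterations to cover.

Lower bounds. `exists_perturbed_sine` adds to the sine `-8 sin (ε t / 4)` bumps `ℓ³ B(t/ℓ)` at knots
`ℓ` apart. They alter slopes by multiples of `ℓ²` and curvatures by multiples of `ℓ`, while the
Lipschitz constant of the second derivative stays bounded, whatever the number of knots, because the
bumps have disjoint supports. With knots `i h` and curvature `2h cos` where the slope is `-2h² cos`,
the Newton step is exactly `h`: this is the slow example. For M.1 a resisting oracle reports the
sine with curvature raised by `2h`. By `M1Step.bounds` these answers force steps between `δ h` and
`2h`: the lower bound separates the iterates, so that some function of the class fits all answers,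
and the upper bound keeps them where the slope is large. For CRS the plain sine `-2 sin (ε t)`
suffices, as the acceptance test alone limits the moves to order `h`.

Upper bound. By Taylor expansion (`A1.direction_decrease`) a direction either has length at least
`εH` and admits steplengths bounded below, or is of Newton type and nearly annihilates the
linearized gradient. Hence (`long_step_or_small_gradient`) either `θ^(4j) ‖d‖³` is at least of order
`h³`, or a unit step reaches a gradient of norm at most `εg`, which can happen only in the last
iteration counted. The decrease is at least `η/6 θ^(3j) ‖d‖³`; the spare factor `θ^j` pays for the
`j + 1` trials, since `(j + 1) θ^j` is bounded. The number of evaluations is then controlled by a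
telescoping sum of decreases. -/

/-! ### Calculus and operators in one dimension -/

/-- The function on `Eu 1` given by a function of one real variable. -/
def onLine (φ : ℝ → ℝ) : Eu 1 → ℝ := fun y => φ (y 0)

/-- The point of `Eu 1` with coordinate `t`. -/
noncomputable abbrev pt (t : ℝ) : Eu 1 := EuclideanSpace.single 0 t

theorem pt_coord (y : Eu 1) : pt (y 0) = y := by
  ext i; fin_cases i; simp

theorem norm_eu_one (y : Eu 1) : ‖y‖ = |y 0| := by
  rw [← pt_coord y]; simp

theorem eu_one_ext {x y : Eu 1} (h : x 0 = y 0) : x = y := by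
  rw [← pt_coord x, h, pt_coord]

theorem inner_eu_one (x y : Eu 1) : inner ℝ x y = x 0 * y 0 := by
  simp [PiLp.inner_apply, mul_comm]

/-- The coordinate of a point of `Eu 1`, as a continuous linear form. -/
noncomputable def coord : Eu 1 →L[ℝ] ℝ := innerSL ℝ (pt 1)

@[simp]
theorem coord_apply (y : Eu 1) : coord y = y 0 := by
  simp [coord, inner_eu_one]

/-- The operator `y ↦ m y` on `Eu 1`. -/
noncomputable def scal (m : ℝ) : Eu 1 →L[ℝ] Eu 1 := coord.smulRight (pt m)

@[simp]
theorem scal_apply (m : ℝ) (y : Eu 1) : scal m y = m • y :=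
  eu_one_ext (by simp [scal, mul_comm])

/-- Reduces the matrices `M` of the class M.1 to numbers. -/
theorem clm_eu_one (T : Eu 1 →L[ℝ] Eu 1) : T = scal (T (pt 1) 0) := by
  ext1 y
  have : y = y 0 • pt 1 := eu_one_ext (by simp)
  rw [this, map_smul]
  exact eu_one_ext (by simp [mul_comm])

theorem scal_sub (a b : ℝ) : scal a - scal b = scal (a - b) := by
  ext1 y
  exact eu_one_ext (by simp [sub_mul])

theorem scal_add (a b : ℝ) : scal a + scal b = scal (a + b) := by
  ext1 y
  exact eu_one_ext (by simp [add_mul])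

theorem norm_scal_le (m : ℝ) : ‖scal m‖ ≤ |m| :=
  ContinuousLinearMap.opNorm_le_bound _ (abs_nonneg m) fun y => by simp [norm_smul]

theorem lamMin_scal (m : ℝ) : lamMin (scal m) = m := by
  have : {μ : ℝ | Module.End.HasEigenvalue (scal m : Eu 1 →ₗ[ℝ] Eu 1) μ} = {m} := by
    ext μ
    constructor
    · intro h
      obtain ⟨v, hv⟩ := Module.End.HasEigenvalue.exists_hasEigenvector h
      have h1 := hv.apply_eq_smul
      have h2 := hv.2
      simp only [ContinuousLinearMap.coe_coe, scal_apply] at h1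
      exact (smul_left_injective ℝ h2 h1).symm
    · rintro rfl
      refine Module.End.hasEigenvalue_of_hasEigenvector (x := pt 1) ⟨?_, ?_⟩
      · rw [Module.End.mem_eigenspace_iff]; simp
      · intro h; simpa using congrArg (fun y : Eu 1 => y 0) h
  rw [lamMin, this, csInf_singleton]

theorem scal_isPositive_iff (m : ℝ) : (scal m).IsPositive ↔ 0 ≤ m := by
  constructor
  · intro h
    simpa [inner_eu_one] using h.inner_nonneg_left (pt 1)
  · intro h
    refine ⟨fun x y => ?_, fun x => ?_⟩
    · simp [inner_eu_one]; ring
    · simp [ContinuousLinearMap.reApplyInnerSelf, inner_eu_one]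
      nlinarith [mul_self_nonneg (x 0)]

/-- `φ` is twice differentiable with first and second derivatives `φ₁`, `φ₂`, the latter bounded by
`L` and `L`-Lipschitz. -/
structure TwiceDiff (L : ℝ) (φ φ₁ φ₂ : ℝ → ℝ) : Prop where
  deriv_one : ∀ t, HasDerivAt φ (φ₁ t) t
  deriv_two : ∀ t, HasDerivAt φ₁ (φ₂ t) t
  bound : ∀ t, |φ₂ t| ≤ L
  lip : ∀ s t, |φ₂ s - φ₂ t| ≤ L * |s - t|

namespace TwiceDiff

variable {L : ℝ} {φ φ₁ φ₂ : ℝ → ℝ}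

theorem gradient_eq (h : TwiceDiff L φ φ₁ φ₂) (y : Eu 1) :
    gradient (onLine φ) y = pt (φ₁ (y 0)) := by
  apply HasGradientAt.gradient
  rw [hasGradientAt_iff_hasFDerivAt]
  have h1 : HasFDerivAt (fun y => coord y) coord y := coord.hasFDerivAt
  have h2 := (h.deriv_one (coord y)).comp_hasFDerivAt y h1
  have h3 : InnerProductSpace.toDual ℝ (Eu 1) (pt (φ₁ (y 0))) = φ₁ (coord y) • coord := by
    ext v
    simp [inner_eu_one]
  rw [h3]
  exact h2.congr_of_eventuallyEq (.of_forall fun z => by simp [onLine])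

theorem hess_eq (h : TwiceDiff L φ φ₁ φ₂) (y : Eu 1) :
    hess (onLine φ) y = scal (φ₂ (y 0)) := by
  have h0 : gradient (onLine φ) = fun y => φ₁ (coord y) • pt 1 := by
    ext1 y; rw [h.gradient_eq]; exact eu_one_ext (by simp)
  rw [hess, h0]
  apply HasFDerivAt.fderiv
  have h1 : HasFDerivAt (fun y => coord y) coord y := coord.hasFDerivAt
  have h2 := ((h.deriv_two (coord y)).comp_hasFDerivAt y h1).smul_const (pt 1)
  have h3 : scal (φ₂ (y 0)) = (φ₂ (coord y) • coord).smulRight (pt 1) := by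
    ext1 v
    exact eu_one_ext (by simp)
  rw [h3]
  exact h2

theorem lamMin_eq (h : TwiceDiff L φ φ₁ φ₂) (y : Eu 1) :
    lamMin (hess (onLine φ) y) = φ₂ (y 0) := by
  rw [h.hess_eq, lamMin_scal]

theorem norm_gradient (h : TwiceDiff L φ φ₁ φ₂) (y : Eu 1) :
    ‖gradient (onLine φ) y‖ = |φ₁ (y 0)| := by
  rw [h.gradient_eq, norm_eu_one]; simp

theorem gradCurv_eq (h : TwiceDiff L φ φ₁ φ₂) (y : Eu 1) (hg : φ₁ (y 0) ≠ 0) :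
    gradCurv (onLine φ) y = φ₂ (y 0) := by
  rw [gradCurv, h.norm_gradient, h.hess_eq, h.gradient_eq, inner_eu_one, sq_abs]
  simp only [scal_apply, PiLp.smul_apply, PiLp.single_apply, if_true, smul_eq_mul]
  field_simp

theorem contDiff (h : TwiceDiff L φ φ₁ φ₂) : ContDiff ℝ 2 φ := by
  have d1 : deriv φ = φ₁ := funext fun t => (h.deriv_one t).deriv
  have d2 : deriv φ₁ = φ₂ := funext fun t => (h.deriv_two t).deriv
  have hc : Continuous φ₂ := by
    have : LipschitzWith L.toNNReal φ₂ := LipschitzWith.of_dist_le_mul fun s t => by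
      rw [Real.dist_eq, Real.dist_eq]
      exact (h.lip s t).trans (by gcongr; exact Real.le_coe_toNNReal L)
    exact this.continuous
  rw [show (2 : WithTop ℕ∞) = 1 + 1 by norm_num, contDiff_succ_iff_deriv]
  refine ⟨fun t => (h.deriv_one t).differentiableAt, by simp, ?_⟩
  rw [d1, contDiff_one_iff_deriv, d2]
  exact ⟨fun t => (h.deriv_two t).differentiableAt, hc⟩

theorem a1 (h : TwiceDiff L φ φ₁ φ₂) {m : ℝ} (hm : ∀ t, m ≤ φ t) : A1 L L (onLine φ) where
  contDiff := by
    have := h.contDiff.comp coord.contDiff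
    convert this using 1
    ext y
    simp [onLine]
  bddBelow := ⟨m, by rintro _ ⟨y, rfl⟩; exact hm _⟩
  lip_grad x y := by
    rw [h.gradient_eq, h.gradient_eq, norm_eu_one, norm_eu_one]
    have := Convex.norm_image_sub_le_of_norm_hasDerivWithin_le (s := Set.univ)
      (fun t _ => (h.deriv_two t).hasDerivWithinAt) (fun t _ => h.bound t) convex_univ
      (Set.mem_univ (y 0)) (Set.mem_univ (x 0))
    simpa using this
  lip_hess x y := by
    rw [h.hess_eq, h.hess_eq, scal_sub, norm_eu_one]
    exact (norm_scal_le _).trans (by simpa using h.lip (x 0) (y 0))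

end TwiceDiff

/-! ### A sine with local corrections of slope and curvature -/

/-- `B` has first and second derivatives `B₁`, `B₂`, all three are bounded by `M` and vanish outside
`(-1/2, 1/2)`, and `B₂` is `M`-Lipschitz. -/
structure LocalFun (M : ℝ) (B B₁ B₂ : ℝ → ℝ) : Prop where
  deriv_one : ∀ t, HasDerivAt B (B₁ t) t
  deriv_two : ∀ t, HasDerivAt B₁ (B₂ t) t
  supp : ∀ t, 1 / 2 ≤ |t| → B t = 0 ∧ B₁ t = 0 ∧ B₂ t = 0
  bound : ∀ t, |B t| ≤ M ∧ |B₁ t| ≤ M ∧ |B₂ t| ≤ M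
  lip : ∀ s t, |B₂ s - B₂ t| ≤ M * |s - t|

/-- Every 2-jet at the origin of a smooth function is that of a smooth function with support in
`(-1/2, 1/2)`. -/
theorem exists_localFun (p : ℝ → ℝ) (hp : ContDiff ℝ (⊤ : ℕ∞) p) :
    ∃ (M : ℝ) (B B₁ B₂ : ℝ → ℝ), LocalFun M B B₁ B₂ ∧
      B 0 = p 0 ∧ B₁ 0 = deriv p 0 ∧ B₂ 0 = deriv (deriv p) 0 := by
  -- The bump is 1 near the origin, so the jet is kept; the outer radius only has to be below `1/2`.
  let ζ : ContDiffBump (0 : ℝ) := ⟨1 / 8, 1 / 4, by norm_num, by norm_num⟩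
  set B : ℝ → ℝ := fun t => p t * ζ t with hB
  have hs : ContDiff ℝ (⊤ : ℕ∞) B := hp.mul ζ.contDiff
  have hs1 : ContDiff ℝ (⊤ : ℕ∞) (deriv B) := (contDiff_infty_iff_deriv.1 hs).2
  have hs2 : ContDiff ℝ (⊤ : ℕ∞) (deriv (deriv B)) := (contDiff_infty_iff_deriv.1 hs1).2
  have hc : HasCompactSupport B := ζ.hasCompactSupport.mul_left
  have hc1 := hc.deriv
  have hc2 := hc1.deriv
  obtain ⟨M0, hM0⟩ := hc.exists_bound_of_continuous hs.continuous
  obtain ⟨M1, hM1⟩ := hc1.exists_bound_of_continuous hs1.continuous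
  obtain ⟨M2, hM2⟩ := hc2.exists_bound_of_continuous hs2.continuous
  obtain ⟨M3, hM3⟩ := ContDiff.lipschitzWith_of_hasCompactSupport hc2 hs2 (by simp)
  have ht : tsupport B ⊆ Metric.closedBall 0 (1 / 4) :=
    (tsupport_mul_subset_right).trans (by rw [ζ.tsupport_eq])
  have hnear : B =ᶠ[nhds 0] p := by
    filter_upwards [ζ.eventuallyEq_one] with t h
    simp [hB, h]
  refine ⟨max (max M0 M1) (max M2 M3), B, deriv B, deriv (deriv B),
    ⟨fun t => (hs.differentiable (by simp) t).hasDerivAt,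
      fun t => (hs1.differentiable (by simp) t).hasDerivAt, fun t h => ?_, fun t => ?_,
      fun s t => ?_⟩, hnear.eq_of_nhds, hnear.deriv_eq, hnear.deriv.deriv_eq⟩
  · have h0 : t ∉ tsupport B := fun h' => by
      have := ht h'
      rw [mem_closedBall_zero_iff, Real.norm_eq_abs] at this
      linarith
    have h1 : t ∉ tsupport (deriv B) := fun h' => h0 (tsupport_deriv_subset h')
    have h2 : t ∉ tsupport (deriv (deriv B)) := fun h' => h1 (tsupport_deriv_subset h')
    exact ⟨image_eq_zero_of_notMem_tsupport h0, image_eq_zero_of_notMem_tsupport h1,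
      image_eq_zero_of_notMem_tsupport h2⟩
  · exact ⟨(hM0 t).trans (by simp), (hM1 t).trans (by simp), (hM2 t).trans (by simp)⟩
  · have := hM3.dist_le_mul s t
    rw [Real.dist_eq, Real.dist_eq] at this
    exact this.trans (by gcongr; simp)

/-- The points `y i`, `i < m`, have mutual distances at least `ℓ`. -/
def Separated (ℓ : ℝ) (m : ℕ) (y : ℕ → ℝ) : Prop :=
  ∀ i < m, ∀ k < m, i ≠ k → ℓ ≤ |y i - y k|

/-- A combination of translates of `w`. -/
def translates (w : ℝ → ℝ) (m : ℕ) (y c : ℕ → ℝ) (t : ℝ) : ℝ :=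
  ∑ i ∈ Finset.range m, c i * w (t - y i)

section Translates

variable {m : ℕ} {y c : ℕ → ℝ} {w : ℝ → ℝ} {A M : ℝ}

/-- Knots are at distance at least 1 and supports have half-width `1/2`, so within `1/2` of one knot
the other translates vanish. -/
theorem translates_eq_single (hy : Separated 1 m y) (hw : ∀ t, 1 / 2 ≤ |t| → w t = 0) {t : ℝ}
    {k : ℕ} (hk : k < m) (ht : |t - y k| < 1 / 2) :
    translates w m y c t = c k * w (t - y k) := by
  refine Finset.sum_eq_single k (fun i hi hik => ?_) (fun h => absurd (Finset.mem_range.2 hk) h)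
  have h1 := hy i (Finset.mem_range.1 hi) k hk hik
  have h2 : |y i - y k| ≤ |t - y k| + |t - y i| := by
    have := abs_sub (t - y k) (t - y i)
    rwa [show t - y k - (t - y i) = y i - y k by ring] at this
  rw [hw _ (by linarith), mul_zero]

theorem translates_apply_knot (hy : Separated 1 m y) (hw : ∀ t, 1 / 2 ≤ |t| → w t = 0)
    {k : ℕ} (hk : k < m) : translates w m y c (y k) = c k * w 0 := by
  rw [translates_eq_single hy hw hk (by simp), sub_self]

theorem abs_translates_le (hy : Separated 1 m y) (hw : ∀ t, 1 / 2 ≤ |t| → w t = 0)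
    (hM : ∀ t, |w t| ≤ M) (hA : 0 ≤ A) (hc : ∀ i < m, |c i| ≤ A) (t : ℝ) :
    |translates w m y c t| ≤ A * M := by
  have hM0 : 0 ≤ M := (abs_nonneg _).trans (hM 0)
  by_cases h : ∃ k < m, |t - y k| < 1 / 2
  · obtain ⟨k, hk, ht⟩ := h
    rw [translates_eq_single hy hw hk ht, abs_mul]
    exact mul_le_mul (hc k hk) (hM _) (abs_nonneg _) hA
  · push Not at h
    rw [translates, Finset.sum_eq_zero fun i hi => by
      rw [hw _ (h i (Finset.mem_range.1 hi)), mul_zero], abs_zero]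
    positivity

/-- Only the translates whose support contains `s` or `t` contribute to the difference. There is at
most one for each point, hence the factor 2 independent of `m`. -/
theorem translates_lip (hy : Separated 1 m y) (hw : ∀ t, 1 / 2 ≤ |t| → w t = 0)
    (hM : ∀ s t, |w s - w t| ≤ M * |s - t|) (hA : 0 ≤ A) (hc : ∀ i < m, |c i| ≤ A) (s t : ℝ) :
    |translates w m y c s - translates w m y c t| ≤ 2 * (A * M) * |s - t| := by
  have hM0 : 0 ≤ M := by have := (abs_nonneg _).trans (hM 1 0); simpa using this
  set ι : ℝ → ℝ := fun t => if |t| < 1 / 2 then 1 else 0 with hι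
  -- The indicator `ι` is itself a function vanishing outside the support interval, so the sup bound
  -- for translates does the counting.
  have hcount : ∀ t, ∑ i ∈ Finset.range m, ι (t - y i) ≤ 1 := fun t => by
    have := abs_translates_le (w := ι) (c := fun _ => 1) (A := 1) (M := 1) hy
      (fun t ht => by simp only [hι]; rw [if_neg (not_lt.2 ht)])
      (fun t => by simp only [hι]; split_ifs <;> simp) zero_le_one (by simp) t
    rw [translates] at this
    simpa using (le_abs_self _).trans this
  have hterm : ∀ i ∈ Finset.range m, |c i * w (s - y i) - c i * w (t - y i)| ≤
      A * M * |s - t| * (ι (s - y i) + ι (t - y i)) := fun i hi => by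
    have h1 : |c i * w (s - y i) - c i * w (t - y i)| ≤ A * M * |s - t| := by
      rw [← mul_sub, abs_mul, mul_assoc]
      have := hM (s - y i) (t - y i)
      rw [sub_sub_sub_cancel_right] at this
      exact mul_le_mul (hc i (Finset.mem_range.1 hi)) this (abs_nonneg _) hA
    have h0 : 0 ≤ A * M * |s - t| := by positivity
    by_cases hs : |s - y i| < 1 / 2 <;> by_cases ht : |t - y i| < 1 / 2
    · simp only [hι, hs, ht, if_true]; linarith
    · simp only [hι, hs, ht, if_true, if_false]; linarith
    · simp only [hι, hs, ht, if_true, if_false]; linarith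
    · rw [hw _ (not_lt.1 hs), hw _ (not_lt.1 ht)]; simp only [hι, if_neg hs, if_neg ht]; simp
  calc |translates w m y c s - translates w m y c t|
      = |∑ i ∈ Finset.range m, (c i * w (s - y i) - c i * w (t - y i))| := by
        rw [Finset.sum_sub_distrib]; rfl
    _ ≤ ∑ i ∈ Finset.range m, A * M * |s - t| * (ι (s - y i) + ι (t - y i)) :=
        (Finset.abs_sum_le_sum_abs _ _).trans (Finset.sum_le_sum hterm)
    _ = A * M * |s - t| * (∑ i ∈ Finset.range m, ι (s - y i) +
          ∑ i ∈ Finset.range m, ι (t - y i)) := by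
        rw [← Finset.mul_sum, Finset.sum_add_distrib]
    _ ≤ A * M * |s - t| * (1 + 1) := by gcongr <;> apply hcount
    _ = 2 * (A * M) * |s - t| := by ring

theorem hasDerivAt_translates {w' : ℝ → ℝ} (hw : ∀ t, HasDerivAt w (w' t) t) (t : ℝ) :
    HasDerivAt (translates w m y c) (translates w' m y c t) t := by
  have : HasDerivAt (fun t => ∑ i ∈ Finset.range m, c i * w (t - y i))
      (∑ i ∈ Finset.range m, c i * w' (t - y i)) t :=
    HasDerivAt.fun_sum fun i _ =>
      ((hw (t - y i)).comp_sub_const t (y i)).const_mul (c i)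
  exact this

end Translates

/-- A slowly decreasing function with prescribed corrections of slope and curvature at separated
knots. -/
theorem exists_perturbed_sine : ∃ M : ℝ, 0 < M ∧
    ∀ ε ∈ Set.Ioo (0 : ℝ) 1, ∀ ℓ ∈ Set.Ioc (0 : ℝ) 1, ∀ A : ℝ, 0 ≤ A → ∀ (m : ℕ) (x u a : ℕ → ℝ),
    Separated ℓ m x → (∀ i < m, |u i| ≤ A) → (∀ i < m, |a i| ≤ A) →
    ∃ φ φ₁ φ₂ : ℝ → ℝ, TwiceDiff (1 + A * M) φ φ₁ φ₂ ∧ (∀ t, |φ t| ≤ 8 + A * M) ∧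
      ∀ i < m, φ (x i) = -8 * Real.sin (ε * x i / 4) ∧
        φ₁ (x i) = -2 * ε * Real.cos (ε * x i / 4) + ℓ ^ 2 * u i ∧
        φ₂ (x i) = ε ^ 2 / 2 * Real.sin (ε * x i / 4) + ℓ * a i := by
  -- `B` has the jet `(0, 1, 0)` and `D` the jet `(0, 0, 1)`: they correct slope and curvature
  -- separately and leave the value alone.
  obtain ⟨M, B, B₁, B₂, hB, hB0, hB1, hB2⟩ := exists_localFun (fun t => t) contDiff_id
  obtain ⟨M', D, D₁, D₂, hD, hD0, hD1, hD2⟩ := exists_localFun (fun t => t ^ 2 / 2)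
    ((contDiff_id.pow 2).div_const 2)
  have e1 : deriv (fun t : ℝ => t ^ 2 / 2) = fun t => t := by ext t; simp
  simp only [deriv_id'', deriv_const, e1] at hB0 hB1 hB2 hD0 hD1 hD2
  norm_num at hD0
  have hM : 0 ≤ M := (abs_nonneg _).trans (hB.bound 0).1
  have hM' : 0 ≤ M' := (abs_nonneg _).trans (hD.bound 0).1
  -- The factor 2 is the loss in `translates_lip`; the summand 1 makes the constant positive.
  refine ⟨2 * (M + M') + 1, by positivity, fun ε hε ℓ hℓ A hA m x u a hx hu ha => ?_⟩
  obtain ⟨hε0, hε1⟩ := hε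
  obtain ⟨hℓ0, hℓ1⟩ := hℓ
  set y : ℕ → ℝ := fun i => x i / ℓ with hy'
  have hy : Separated 1 m y := fun i hi k hk hik => by
    have := hx i hi k hk hik
    simp only [hy', ← sub_div, abs_div, abs_of_pos hℓ0]
    rwa [le_div_iff₀ hℓ0, one_mul]
  set T : (ℝ → ℝ) → (ℝ → ℝ) → ℝ → ℝ := fun w v t => translates w m y u t + translates v m y a t
    with hT
  have hTb : ∀ w v : ℝ → ℝ, (∀ t, 1 / 2 ≤ |t| → w t = 0) → (∀ t, 1 / 2 ≤ |t| → v t = 0) →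
      (∀ t, |w t| ≤ M) → (∀ t, |v t| ≤ M') → ∀ t, |T w v t| ≤ A * (2 * (M + M') + 1) := by
    intro w v hw hv hw' hv' t
    have h1 := abs_translates_le hy hw hw' hA hu t
    have h2 := abs_translates_le hy hv hv' hA ha t
    have h3 := abs_add_le (translates w m y u t) (translates v m y a t)
    have h4 := mul_nonneg hA hM
    have h5 := mul_nonneg hA hM'
    simp only [hT]
    nlinarith
  have hTd : ∀ w w' v v' : ℝ → ℝ, (∀ t, HasDerivAt w (w' t) t) → (∀ t, HasDerivAt v (v' t) t) →
      ∀ t, HasDerivAt (fun t => T w v (t / ℓ)) (T w' v' (t / ℓ) / ℓ) t := by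
    intro w w' v v' hw hv t
    have h1 : HasDerivAt (T w v) (T w' v' (t / ℓ)) (t / ℓ) :=
      (hasDerivAt_translates hw _).add (hasDerivAt_translates hv _)
    have h2 := h1.comp t ((hasDerivAt_id t).div_const ℓ)
    simpa [Function.comp_def, div_eq_mul_inv] using h2
  have hlin : ∀ t, HasDerivAt (fun t => ε * t / 4) (ε / 4) t := fun t => by
    simpa using ((hasDerivAt_id t).const_mul ε).div_const 4
  have hε2 : ε ^ 2 ≤ 1 := by nlinarith
  have hpow : ∀ k, |ℓ ^ k| ≤ 1 := fun k => by
    rw [abs_of_nonneg (by positivity)]; exact pow_le_one₀ hℓ0.le hℓ1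
  have hscale : ∀ k (z Z : ℝ), |z| ≤ Z → |ℓ ^ k * z| ≤ Z := fun k z Z h => by
    rw [abs_mul]
    exact (mul_le_of_le_one_left (abs_nonneg _) (hpow k)).trans h
  -- Each derivative costs a factor `ℓ⁻¹`, so the prefactor `ℓ³` leaves a Lipschitz constant of the
  -- second derivative that is free of `ℓ`.
  refine ⟨fun t => -8 * Real.sin (ε * t / 4) + ℓ ^ 3 * T B D (t / ℓ),
    fun t => -2 * ε * Real.cos (ε * t / 4) + ℓ ^ 2 * T B₁ D₁ (t / ℓ),
    fun t => ε ^ 2 / 2 * Real.sin (ε * t / 4) + ℓ ^ 1 * T B₂ D₂ (t / ℓ),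
    ⟨fun t => ?_, fun t => ?_, fun t => ?_, fun s t => ?_⟩, fun t => ?_, fun i hi => ?_⟩
  · have h1 := ((hlin t).sin.const_mul (-8)).fun_add
      ((hTd B B₁ D D₁ hB.deriv_one hD.deriv_one t).const_mul (ℓ ^ 3))
    refine h1.congr_deriv ?_
    field_simp
    ring
  · have h1 := ((hlin t).cos.const_mul (-2 * ε)).fun_add
      ((hTd B₁ B₂ D₁ D₂ hB.deriv_two hD.deriv_two t).const_mul (ℓ ^ 2))
    refine h1.congr_deriv ?_
    field_simp
    ring
  · have h1 := hscale 1 _ _ (hTb B₂ D₂ (fun t h => (hB.supp t h).2.2) (fun t h => (hD.supp t h).2.2)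
      (fun t => (hB.bound t).2.2) (fun t => (hD.bound t).2.2) (t / ℓ))
    refine (abs_add_le _ _).trans (add_le_add ?_ h1)
    rw [abs_mul, abs_of_nonneg (by positivity)]
    have := Real.abs_sin_le_one (ε * t / 4)
    nlinarith [abs_nonneg (Real.sin (ε * t / 4))]
  · have h1 := translates_lip hy (fun t h => (hB.supp t h).2.2) hB.lip hA hu (s / ℓ) (t / ℓ)
    have h2 := translates_lip hy (fun t h => (hD.supp t h).2.2) hD.lip hA ha (s / ℓ) (t / ℓ)
    rw [← sub_div, abs_div, abs_of_pos hℓ0] at h1 h2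
    have h3 : |T B₂ D₂ (s / ℓ) - T B₂ D₂ (t / ℓ)| ≤ 2 * (A * M + A * M') * (|s - t| / ℓ) := by
      have := abs_add_le (translates B₂ m y u (s / ℓ) - translates B₂ m y u (t / ℓ))
        (translates D₂ m y a (s / ℓ) - translates D₂ m y a (t / ℓ))
      simp only [hT]
      rw [add_sub_add_comm]
      linarith
    have h4 : |ℓ ^ 1 * T B₂ D₂ (s / ℓ) - ℓ ^ 1 * T B₂ D₂ (t / ℓ)| ≤
        2 * (A * M + A * M') * |s - t| := by
      rw [← mul_sub, abs_mul, pow_one, abs_of_pos hℓ0]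
      calc ℓ * |T B₂ D₂ (s / ℓ) - T B₂ D₂ (t / ℓ)|
          ≤ ℓ * (2 * (A * M + A * M') * (|s - t| / ℓ)) := by gcongr
        _ = 2 * (A * M + A * M') * |s - t| := by field_simp
    have h5 : |ε ^ 2 / 2 * Real.sin (ε * s / 4) - ε ^ 2 / 2 * Real.sin (ε * t / 4)| ≤
        1 * |s - t| := by
      rw [← mul_sub, abs_mul, abs_of_nonneg (by positivity)]
      have h6 : |Real.sin (ε * s / 4) - Real.sin (ε * t / 4)| ≤ |ε * s / 4 - ε * t / 4| :=
        Real.abs_sin_sub_sin_le _ _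
      rw [show ε * s / 4 - ε * t / 4 = ε / 4 * (s - t) by ring, abs_mul,
        abs_of_pos (by positivity : 0 < ε / 4)] at h6
      have := abs_nonneg (s - t)
      calc ε ^ 2 / 2 * |Real.sin (ε * s / 4) - Real.sin (ε * t / 4)|
          ≤ 1 * (1 * |s - t|) := by
            gcongr
            · linarith
            · exact h6.trans (by gcongr; linarith)
        _ = 1 * |s - t| := by ring
    have h6 := abs_add_le (ε ^ 2 / 2 * Real.sin (ε * s / 4) - ε ^ 2 / 2 * Real.sin (ε * t / 4))
      (ℓ ^ 1 * T B₂ D₂ (s / ℓ) - ℓ ^ 1 * T B₂ D₂ (t / ℓ))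
    rw [add_sub_add_comm]
    have := mul_nonneg hA (abs_nonneg (s - t))
    nlinarith
  · have h1 := hscale 3 _ _ (hTb B D (fun t h => (hB.supp t h).1) (fun t h => (hD.supp t h).1)
      (fun t => (hB.bound t).1) (fun t => (hD.bound t).1) (t / ℓ))
    refine (abs_add_le _ _).trans (add_le_add ?_ h1)
    rw [abs_mul, abs_neg]
    have := Real.abs_sin_le_one (ε * t / 4)
    norm_num
    linarith
  · have h0 := translates_apply_knot (c := u) hy (fun t h => (hB.supp t h).1) hi
    have h1 := translates_apply_knot (c := u) hy (fun t h => (hB.supp t h).2.1) hi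
    have h2 := translates_apply_knot (c := u) hy (fun t h => (hB.supp t h).2.2) hi
    have h0' := translates_apply_knot (c := a) hy (fun t h => (hD.supp t h).1) hi
    have h1' := translates_apply_knot (c := a) hy (fun t h => (hD.supp t h).2.1) hi
    have h2' := translates_apply_knot (c := a) hy (fun t h => (hD.supp t h).2.2) hi
    simp only [hy'] at h0 h1 h2 h0' h1' h2'
    refine ⟨?_, ?_, ?_⟩
    · simp [hT, hy', h0, h0', hB0, hD0]
    · simp [hT, hy', h1, h1', hB1, hD1]
    · simp [hT, hy', h2, h2', hB2, hD2]

/-! ### Lower bound for the CRS class -/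

theorem rpow_neg_three_halves {ε : ℝ} (hε : 0 < ε) :
    ε ^ (-(3 / 2) : ℝ) = (Real.sqrt ε ^ 3)⁻¹ := by
  rw [Real.rpow_neg hε.le, Real.sqrt_eq_rpow, ← Real.rpow_natCast, ← Real.rpow_mul hε.le]
  norm_num

theorem sqrt_mem_Ioo {ε : ℝ} (hε : ε ∈ Set.Ioo (0 : ℝ) 1) : Real.sqrt ε ∈ Set.Ioo (0 : ℝ) 1 :=
  ⟨Real.sqrt_pos.2 hε.1, by rw [Real.sqrt_lt' one_pos]; simpa using hε.2⟩

/-- Angles up to `1/2` keep a slope of amplitude `2ε` at `7/4 ε` or more, safely above `ε`. -/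
theorem seven_eighths_le_cos {t : ℝ} (ht : |t| ≤ 1 / 2) : 7 / 8 ≤ Real.cos t := by
  have h1 := Real.one_sub_sq_div_two_le_cos (x := t)
  have h2 : t ^ 2 ≤ (1 / 2) ^ 2 := by rw [← sq_abs]; gcongr
  linarith

theorem twiceDiff_sine {ε : ℝ} (hε : ε ∈ Set.Ioo (0 : ℝ) 1) :
    TwiceDiff 2 (fun t => -2 * Real.sin (ε * t)) (fun t => -2 * ε * Real.cos (ε * t))
      (fun t => 2 * ε ^ 2 * Real.sin (ε * t)) := by
  obtain ⟨h0, h1⟩ := hε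
  have hlin : ∀ t, HasDerivAt (fun t => ε * t) ε t := fun t => by
    simpa using (hasDerivAt_id t).const_mul ε
  have h2 : ε ^ 2 ≤ 1 := by nlinarith
  refine ⟨fun t => ?_, fun t => ?_, fun t => ?_, fun s t => ?_⟩
  · exact ((hlin t).sin.const_mul (-2)).congr_deriv (by ring)
  · exact ((hlin t).cos.const_mul (-2 * ε)).congr_deriv (by ring)
  · rw [abs_mul, abs_of_nonneg (by positivity)]
    have := Real.abs_sin_le_one (ε * t)
    nlinarith [abs_nonneg (Real.sin (ε * t))]
  · have h3 := Real.abs_sin_sub_sin_le (ε * s) (ε * t)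
    rw [← mul_sub, abs_mul, abs_of_pos h0] at h3
    rw [← mul_sub, abs_mul, abs_of_nonneg (by positivity)]
    calc 2 * ε ^ 2 * |Real.sin (ε * s) - Real.sin (ε * t)|
        ≤ 2 * 1 * (1 * |s - t|) := by
          gcongr
          exact h3.trans (by gcongr)
      _ = 2 * |s - t| := by ring

/-- No method of the CRS class has a complexity of better order than `ε ^ (-3/2)`. -/
theorem crs_lower_bound {ηc : ℝ} (hη : 0 < ηc) (σbar κ₁ κ₂ : ℝ) :
    ∃ L a b c : ℝ, 0 < c ∧ ∀ ε ∈ Set.Ioo (0 : ℝ) 1,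
      ∃ f : Eu 1 → ℝ, A1 L L f ∧ (∀ y, f y ∈ Set.Icc a b) ∧
        ∀ (N : ℕ) (x s r : ℕ → Eu 1) (lam σL σU : ℕ → ℝ),
          CRSRun σbar ηc κ₁ κ₂ f 0 N x s r lam σL σU →
          ‖gradient f (x N)‖ ≤ ε → c * ε ^ (-(3 / 2) : ℝ) ≤ N := by
  -- Leaving the region `ε |x| < 1/2` takes a distance `1 / (2ε)`, in moves of length at most `√ε /
  -- √(ηc/2)`.
  refine ⟨2, -2, 2, Real.sqrt (ηc / 2) / 2, by positivity, fun ε hε => ?_⟩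
  have hT := twiceDiff_sine hε
  have hbd : ∀ t, -2 * Real.sin (ε * t) ∈ Set.Icc (-2 : ℝ) 2 := fun t => by
    constructor <;> linarith [Real.sin_le_one (ε * t), Real.neg_one_le_sin (ε * t)]
  refine ⟨onLine fun t => -2 * Real.sin (ε * t), hT.a1 fun t => (hbd t).1, fun y => hbd _,
    fun N x s r lam σL σU hrun hN => ?_⟩
  obtain ⟨hh0, hh1⟩ := sqrt_mem_Ioo hε
  set h := Real.sqrt ε with hh
  have hεh : ε = h ^ 2 := (Real.sq_sqrt hε.1.le).symm
  -- The function is `2ε`-Lipschitz, so acceptance gives `ηc |s|³ ≤ 2ε |s|`; a rejected step does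
  -- not move.
  have hstep : ∀ k < N, Real.sqrt (ηc / 2) * |x (k + 1) 0 - x k 0| ≤ h := fun k hk => by
    by_cases hacc : ηc * ‖s k‖ ^ 3 ≤ onLine (fun t => -2 * Real.sin (ε * t)) (x k) -
        onLine (fun t => -2 * Real.sin (ε * t)) (x k + s k)
    · rw [(hrun.accept k hk hacc).1]
      rw [norm_eu_one] at hacc
      simp only [onLine, PiLp.add_apply] at hacc
      simp only [PiLp.add_apply, add_sub_cancel_left]
      have h3 := Real.abs_sin_sub_sin_le (ε * (x k 0 + s k 0)) (ε * x k 0)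
      rw [← mul_sub, add_sub_cancel_left, abs_mul, abs_of_pos hε.1] at h3
      have h4 := (le_abs_self _).trans h3
      rcases (abs_nonneg (s k 0)).eq_or_lt with h0 | h0
      · rw [← h0]; simpa using hh0.le
      · have h5 : ηc / 2 * |s k 0| ^ 2 ≤ ε := by
          have : (ηc / 2 * |s k 0| ^ 2) * |s k 0| ≤ ε * |s k 0| := by nlinarith
          exact le_of_mul_le_mul_right this h0
        rw [hh, ← Real.sqrt_sq (abs_nonneg (s k 0)), ← Real.sqrt_mul (by positivity)]
        exact Real.sqrt_le_sqrt h5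
    · rw [hrun.reject k hk hacc]; simpa using hh0.le
  have hdist : ∀ k ≤ N, Real.sqrt (ηc / 2) * |x k 0| ≤ k * h := by
    intro k
    induction k with
    | zero => intro _; rw [hrun.start]; simp
    | succ k ih =>
      intro hk
      have h1 := ih (by omega)
      have h2 := hstep k (by omega)
      have h3 := abs_add_le (x (k + 1) 0 - x k 0) (x k 0)
      rw [sub_add_cancel] at h3
      have := mul_le_mul_of_nonneg_left h3 (Real.sqrt_nonneg (ηc / 2))
      push_cast
      nlinarith
  rw [hT.norm_gradient] at hN
  have hfar : 1 / 2 ≤ ε * |x N 0| := by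
    by_contra! hlt
    have := seven_eighths_le_cos (t := ε * x N 0) (by rw [abs_mul, abs_of_pos hε.1]; exact hlt.le)
    have h2 := neg_abs_le (-2 * ε * Real.cos (ε * x N 0))
    nlinarith [hε.1]
  have hN' := hdist N le_rfl
  rw [rpow_neg_three_halves hε.1, ← hh, ← div_eq_mul_inv, div_le_iff₀ (by positivity)]
  have h1 := Real.sqrt_nonneg (ηc / 2)
  calc Real.sqrt (ηc / 2) / 2 ≤ Real.sqrt (ηc / 2) * (ε * |x N 0|) := by nlinarith
    _ = ε * (Real.sqrt (ηc / 2) * |x N 0|) := by ring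
    _ ≤ ε * (N * h) := by gcongr; exact hε.1.le
    _ = N * h ^ 3 := by rw [hεh]; ring

/-! ### The slow example for the linesearch algorithm -/

section RW

variable {n : ℕ} {f : Eu n → ℝ} {εg εH : ℝ} {x d : Eu n}

/-- Shows that an execution cannot continue past a stopping point, which gives exact termination in
the slow example. -/
theorem RWStops.not_direction (h : RWStops f εg εH x) : ¬ RWDirection f εg εH x d := by
  obtain ⟨h1, h2, h3⟩ := h
  rintro (⟨hg, hR, -⟩ | ⟨hg, hR, hR', -⟩ | ⟨-, hl, -⟩ | ⟨-, hs, -⟩ | ⟨-, hs, -⟩)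
  · rcases h1 with h1 | h1
    · exact hg h1
    · exact h1.1 hR
  · rcases h1 with h1 | h1
    · exact hg h1
    · exact h1.2 ⟨hR, hR'⟩
  · linarith
  · exact hs ⟨h1, h2, h3⟩
  · exact hs ⟨h1, h2, h3⟩

end RW

/-- Where slope and curvature are large, the only direction is the Newton direction. -/
theorem TwiceDiff.direction_iff {L : ℝ} {φ φ₁ φ₂ : ℝ → ℝ} (h : TwiceDiff L φ φ₁ φ₂) {εg εH : ℝ}
    (hg : 0 < εg) (hH : 0 < εH) {x d : Eu 1} (hx : εg < |φ₁ (x 0)|) (hx' : εH < φ₂ (x 0)) :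
    (RWDirection (onLine φ) εg εH x d → RWNewton (onLine φ) εg εH x d) ∧
    (RWNewton (onLine φ) εg εH x d ↔ φ₂ (x 0) * d 0 = -φ₁ (x 0)) := by
  have h0 : φ₁ (x 0) ≠ 0 := abs_pos.1 (hg.trans hx)
  -- In one dimension the curvature along the gradient and the left-most eigenvalue are both `φ₂`.
  -- As it exceeds `εH`, the tests of all other branches fail.
  have hR := h.gradCurv_eq x h0
  have hl := h.lamMin_eq x
  have hs : ¬ RWStops (onLine φ) εg εH x := fun hs => by
    have := hs.2.1
    rw [h.norm_gradient] at this
    linarith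
  refine ⟨?_, ?_⟩
  · rintro (⟨-, h1, -⟩ | ⟨-, h1, -⟩ | ⟨-, h1, -⟩ | h1 | ⟨-, -, h1, -⟩)
    · linarith
    · linarith [h1.2]
    · linarith
    · exact h1
    · linarith [h1.2]
  · constructor
    · rintro ⟨-, -, -, h1⟩
      rw [h.hess_eq, h.gradient_eq] at h1
      simpa using congrArg (fun y : Eu 1 => y 0) h1
    · intro h1
      refine ⟨Or.inr ⟨by linarith, fun h2 => by linarith [h2.1.2]⟩, hs, by linarith, ?_⟩
      rw [h.hess_eq, h.gradient_eq]
      exact eu_one_ext (by simpa using h1)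

theorem natCeil_sub_one_mul_le_one {t : ℝ} (h0 : 0 < t) : ((⌈t⁻¹⌉₊ : ℝ) - 1) * t ≤ 1 := by
  have h2 := Nat.ceil_lt_add_one (inv_nonneg.2 h0.le)
  have h3 : t⁻¹ * t = 1 := inv_mul_cancel₀ h0.ne'
  nlinarith

/-- An example on which the linesearch algorithm takes `⌈εg ^ (-3/2)⌉` Newton steps. -/
theorem rw_slow_example (η θ : ℝ) (hη : η ∈ Set.Ioc (0 : ℝ) 3) :
    ∃ L a b : ℝ, ∀ εg ∈ Set.Ioo (0 : ℝ) 1, ∀ εH ∈ Set.Ioc (0 : ℝ) (Real.sqrt εg),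
      ∃ f : Eu 1 → ℝ, A1 L L f ∧ (∀ y, f y ∈ Set.Icc a b) ∧
        ∃ (x d : ℕ → Eu 1) (j : ℕ → ℕ),
          RWRun f η θ εg εH 0 ⌈εg ^ (-(3 / 2) : ℝ)⌉₊ x d j ∧
          (∀ k < ⌈εg ^ (-(3 / 2) : ℝ)⌉₊,
            RWNewton f εg εH (x k) (d k) ∧ j k = 0 ∧ εg < ‖gradient f (x k)‖) ∧
          ‖gradient f (x ⌈εg ^ (-(3 / 2) : ℝ)⌉₊)‖ ≤ εg ∧
          RWStops f εg εH (x ⌈εg ^ (-(3 / 2) : ℝ)⌉₊) ∧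
          (∀ (N : ℕ) (x' d' : ℕ → Eu 1) (j' : ℕ → ℕ), RWRun f η θ εg εH 0 N x' d' j' →
            N ≤ ⌈εg ^ (-(3 / 2) : ℝ)⌉₊ ∧ (∀ k ≤ N, x' k = x k) ∧
              ∀ k < N, d' k = d k ∧ j' k = j k) := by
  obtain ⟨M, hM, hsine⟩ := exists_perturbed_sine
  refine ⟨1 + 3 * M, -(8 + 3 * M), 8 + 3 * M, fun ε hε εH hεH => ?_⟩
  obtain ⟨hh0, hh1⟩ := sqrt_mem_Ioo hε
  rw [rpow_neg_three_halves hε.1]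
  set h := Real.sqrt ε with hh
  have hεh : ε = h ^ 2 := (Real.sq_sqrt hε.1.le).symm
  -- Rounding up adds at most `h³ ≤ 1`; the bound 2 keeps all angles `i h³ / 4` at most `1/2`.
  have hKh : (⌈(h ^ 3)⁻¹⌉₊ : ℝ) * h ^ 3 ≤ 2 := by
    have h1 := natCeil_sub_one_mul_le_one (t := h ^ 3) (by positivity)
    have h2 : h ^ 3 ≤ 1 := pow_le_one₀ hh0.le hh1.le
    linarith
  generalize ⌈(h ^ 3)⁻¹⌉₊ = K at hKh
  have hang : ∀ i ≤ K, 0 ≤ ε * (i * h) / 4 ∧ ε * (i * h) / 4 ≤ 1 / 2 := fun i hi => by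
    have h1 : (i : ℝ) * h ^ 3 ≤ K * h ^ 3 := by gcongr
    have h2 : ε * (i * h) = i * h ^ 3 := by rw [hεh]; ring
    rw [h2]
    exact ⟨by positivity, by linarith⟩
  have hcos : ∀ i ≤ K, 7 / 8 ≤ Real.cos (ε * (i * h) / 4) := fun i hi =>
    seven_eighths_le_cos (abs_le.2 ⟨by linarith [(hang i hi).1], (hang i hi).2⟩)
  have hsin : ∀ i ≤ K, 0 ≤ Real.sin (ε * (i * h) / 4) := fun i hi =>
    Real.sin_nonneg_of_nonneg_of_le_pi (hang i hi).1 (by linarith [(hang i hi).2, Real.pi_gt_three])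
  -- Before the last knot the correction turns the curvature of the sine into `2h cos`; at the last
  -- knot it cancels the slope `-2ε cos` and leaves the curvature nonnegative. All corrections are
  -- at most `2 + 1/2` in absolute value, so `A = 3` is enough.
  obtain ⟨φ, φ₁, φ₂, hφ, hbd, hknot⟩ := hsine ε hε h ⟨hh0, hh1.le⟩ 3 (by norm_num) (K + 1)
    (fun i => i * h) (fun i => if i = K then 2 * Real.cos (ε * (i * h) / 4) else 0)
    (fun i => if i = K then 0 else 2 * Real.cos (ε * (i * h) / 4) -
      h ^ 3 / 2 * Real.sin (ε * (i * h) / 4))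
    (fun i _ k _ hik => by
      simp only
      rw [← sub_mul, abs_mul, abs_of_pos hh0]
      have h1 : (1 : ℤ) ≤ |(i : ℤ) - k| := Int.one_le_abs (by omega)
      have h2 : (1 : ℝ) ≤ |(i : ℝ) - k| := by exact_mod_cast h1
      nlinarith)
    (fun i _ => by
      split_ifs
      · rw [abs_mul]
        have := Real.abs_cos_le_one (ε * (i * h) / 4)
        norm_num
        linarith
      · simp)
    (fun i _ => by
      split_ifs
      · simp
      · have h1 := Real.abs_cos_le_one (ε * (i * h) / 4)
        have h2 := Real.abs_sin_le_one (ε * (i * h) / 4)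
        have h3 : h ^ 3 ≤ 1 := pow_le_one₀ hh0.le hh1.le
        have h4 := abs_sub (2 * Real.cos (ε * (i * h) / 4))
          (h ^ 3 / 2 * Real.sin (ε * (i * h) / 4))
        rw [abs_mul, abs_mul, abs_of_nonneg (by positivity : 0 ≤ h ^ 3 / 2)] at h4
        norm_num at h4
        have h5 : h ^ 3 / 2 * |Real.sin (ε * (i * h) / 4)| ≤ 1 / 2 * 1 := by gcongr
        linarith)
  have hval : ∀ i ≤ K, φ (i * h) = -8 * Real.sin (ε * (i * h) / 4) := fun i hi =>
    (hknot i (by omega)).1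
  have hgrad : ∀ i < K, φ₁ (i * h) = -2 * ε * Real.cos (ε * (i * h) / 4) := fun i hi => by
    have := (hknot i (by omega)).2.1
    rwa [if_neg hi.ne, mul_zero, add_zero] at this
  have hcurv : ∀ i < K, φ₂ (i * h) = 2 * h * Real.cos (ε * (i * h) / 4) := fun i hi => by
    have h1 := (hknot i (by omega)).2.2
    rw [if_neg hi.ne] at h1
    rw [h1, hεh]
    ring
  have hgradK : φ₁ (K * h) = 0 := by
    have := (hknot K (by omega)).2.1
    rw [if_pos rfl] at this
    rw [this, hεh]
    ring
  have hcurvK : 0 ≤ φ₂ (K * h) := by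
    have := (hknot K (by omega)).2.2
    rw [if_pos rfl, mul_zero, add_zero] at this
    rw [this]
    have := hsin K le_rfl
    positivity
  have hlarge : ∀ i < K, ε < |φ₁ (i * h)| := fun i hi => by
    rw [hgrad i hi, abs_mul, abs_of_pos (by linarith [hcos i hi.le] :
      0 < Real.cos (ε * (i * h) / 4)), abs_mul, abs_of_pos hε.1]
    norm_num
    nlinarith [hcos i hi.le, hε.1]
  have hlarge' : ∀ i < K, εH < φ₂ (i * h) := fun i hi => by
    rw [hcurv i hi]
    nlinarith [hcos i hi.le, hεH.2]
  have hdir : ∀ i < K, φ₂ (i * h) * h = -φ₁ (i * h) := fun i hi => by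
    rw [hcurv i hi, hgrad i hi, hεh]; ring
  -- The decrease is 8 times a sine increment over the angle `h³/4`, hence at least `7/4 h³`; the
  -- linesearch asks for `η/6 h³ ≤ h³/2`.
  have hdec : ∀ i < K, φ (i * h + h) ≤ φ (i * h) - η / 6 * h ^ 3 := fun i hi => by
    have e : (i : ℝ) * h + h = (i + 1 : ℕ) * h := by push_cast; ring
    rw [e, hval i hi.le, hval (i + 1) hi]
    have hb := hang i hi.le
    have hb' := hang (i + 1) hi
    have e' : ε * ((i + 1 : ℕ) * h) / 4 - ε * (i * h) / 4 = h ^ 3 / 4 := by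
      rw [hεh]; push_cast; ring
    have hmv := (convex_Icc (0 : ℝ) (1 / 2)).mul_sub_le_image_sub_of_le_deriv (f := Real.sin)
      (C := 7 / 8) Real.continuous_sin.continuousOn Real.differentiable_sin.differentiableOn
      (fun t ht => by
        rw [Real.deriv_sin]
        have := interior_subset ht
        exact seven_eighths_le_cos (abs_le.2 ⟨by linarith [this.1], this.2⟩))
      (ε * (i * h) / 4) hb (ε * ((i + 1 : ℕ) * h) / 4) hb' (by
        have : 0 < h ^ 3 := by positivity
        linarith)
    rw [e'] at hmv
    have : 0 < h ^ 3 := by positivity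
    nlinarith [hη.2]
  have hstart : pt ((0 : ℕ) * h) = 0 := eu_one_ext (by simp)
  have hnewton : ∀ k < K, RWNewton (onLine φ) ε εH (pt (k * h)) (pt h) := fun k hk =>
    (hφ.direction_iff hε.1 hεH.1 (by simpa using hlarge k hk)
      (by simpa using hlarge' k hk)).2.2 (by simpa using hdir k hk)
  have hsearch : ∀ k < K, RWLineSearch (onLine φ) η θ (pt (k * h)) (pt h) 0 := fun k hk => by
    refine ⟨?_, fun _ _ => Nat.zero_le _⟩
    simpa [onLine, norm_eu_one, abs_of_pos hh0] using hdec k hk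
  have hfinal : RWStops (onLine φ) ε εH (pt (K * h)) := by
    refine ⟨Or.inl ?_, ?_, ?_⟩
    · rw [hφ.gradient_eq]; exact eu_one_ext (by simpa using hgradK)
    · rw [hφ.norm_gradient]; simpa [hgradK] using hε.1.le
    · rw [hφ.lamMin_eq]
      have : 0 ≤ φ₂ ((pt (K * h) : Eu 1) 0) := by simpa using hcurvK
      linarith [hεH.1]
  refine ⟨onLine φ, hφ.a1 fun t => (abs_le.1 (hbd t)).1, fun y => abs_le.1 (hbd _),
    fun k => pt (k * h), fun _ => pt h, fun _ => 0,
    ⟨hstart, fun k hk => Or.inr (Or.inr (Or.inr (Or.inl (hnewton k hk)))), hsearch,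
      fun k _ => eu_one_ext (by simp; ring)⟩,
    fun k hk => ⟨hnewton k hk, rfl, ?_⟩, hfinal.2.1, hfinal, fun N x' d' j' hrun => ?_⟩
  · rw [hφ.norm_gradient]; simpa using hlarge k hk
  -- The curvature is nonzero, so the Newton equation has only one solution.
  · have huniq : ∀ k < K, ∀ d, RWDirection (onLine φ) ε εH (pt (k * h)) d → d = pt h :=
      fun k hk d hd => by
        have h1 := hφ.direction_iff (d := d) hε.1 hεH.1 (x := pt (k * h))
          (by simpa using hlarge k hk) (by simpa using hlarge' k hk)
        have h2 := h1.2.1 (h1.1 hd)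
        simp only [PiLp.single_apply, if_true] at h2
        have h3 : φ₂ (k * h) ≠ 0 := by linarith [hlarge' k hk, hεH.1] |> ne_of_gt
        apply eu_one_ext
        simpa using mul_left_cancel₀ h3 (h2.trans (hdir k hk).symm)
    have hx : ∀ k ≤ N, k ≤ K ∧ x' k = pt (k * h) := by
      intro k
      induction k with
      | zero => intro _; exact ⟨Nat.zero_le _, hrun.start.trans hstart.symm⟩
      | succ k ih =>
        intro hk
        obtain ⟨h1, h2⟩ := ih (by omega)
        have h3 := hrun.direction k hk
        rw [h2] at h3
        have h4 : k < K := by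
          refine lt_of_le_of_ne h1 fun e => ?_
          rw [e] at h3
          exact hfinal.not_direction h3
        have h5 := huniq k h4 _ h3
        have h6 := hrun.search k hk
        rw [h2, h5] at h6
        refine ⟨h4, ?_⟩
        rw [hrun.next k hk, h2, h5, h6.unique (hsearch k h4)]
        exact eu_one_ext (by simp; ring)
    refine ⟨(hx N le_rfl).1, fun k hk => (hx k hk).2, fun k hk => ?_⟩
    have h1 := hrun.direction k hk
    have h2 := hrun.search k hk
    have h4 : k < K := (hx (k + 1) hk).1
    rw [(hx k hk.le).2] at h1 h2
    have h5 := huniq k h4 _ h1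
    rw [h5] at h2
    exact ⟨h5, h2.unique (hsearch k h4)⟩

/-! ### Lower bound for the class M.1: a resisting oracle -/

/-- A step of the class M.1 in one dimension has a length of the order of `√ε` where the slope is
negative and of order `ε` and the curvature positive and of order `√ε`. -/
theorem M1Step.bounds {κrg κrs κl κs h g H : ℝ} (h0 : 0 ≤ κrg) (h1 : κrg < 1) (hκ : 1 < κl)
    (hh : 0 < h) (hg : h ^ 2 ≤ g) (hg' : g ≤ 2 * h ^ 2) (hH : 2 * h ≤ H) (hH' : H ≤ 3 * h)
    {s : Eu 1} (hs : M1Step κrg κrs κl κs (pt (-g)) (scal H) s) :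
    (1 - κrg) / (3 * κl) * h ≤ s 0 ∧ s 0 ≤ 2 * h := by
  obtain ⟨-, -, T, r, hT, hHT, heq, hr, hl⟩ := hs
  obtain ⟨m, rfl⟩ : ∃ m, T = scal m := ⟨_, clm_eu_one T⟩
  rw [scal_isPositive_iff] at hT
  rw [lamMin_scal, lamMin_scal] at hl
  have hr1 := hr.trans (min_le_left _ _)
  have hgpos : 0 < g := lt_of_lt_of_le (by positivity) hg
  have hng : ‖(pt (-g) : Eu 1)‖ = g := by simp [abs_of_pos hgpos]
  rw [hng] at hr1 hl
  rw [norm_eu_one, abs_le] at hr1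
  have heq0 : (H + m) * s 0 = g + r 0 := by
    have := congrArg (fun y : Eu 1 => y 0) heq
    rw [scal_add] at this
    simpa using this
  have hsq : Real.sqrt g ≤ 3 * h := by
    rw [Real.sqrt_le_left (by positivity)]; nlinarith
  have hmax : max |H| (Real.sqrt g) ≤ 3 * h := by
    rw [abs_of_nonneg (by linarith)]; exact max_le hH' hsq
  -- The eigenvalue condition caps `H + m`, which bounds the step from below; `H ≥ 2h` with `m ≥ 0`
  -- and `|r| ≤ g` bounds it from above.
  have hl' : H + m ≤ 3 * κl * h := by nlinarith
  have hpos : 0 < H + m := by linarith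
  have hs0 : 0 < s 0 := by
    by_contra! hneg
    nlinarith
  constructor
  · rw [div_mul_eq_mul_div, div_le_iff₀ (by positivity)]
    have h2 : (1 - κrg) * g ≤ (H + m) * s 0 := by linarith
    have h3 : (1 - κrg) * h ^ 2 ≤ (1 - κrg) * g := by gcongr
    have h4 : (H + m) * s 0 ≤ 3 * κl * h * s 0 := by gcongr
    have h5 : (1 - κrg) * h * h ≤ s 0 * (3 * κl) * h := by nlinarith
    exact le_of_mul_le_mul_right h5 hh
  · have h2 : 2 * h * s 0 ≤ 2 * h * (2 * h) := by nlinarith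
    exact le_of_mul_le_mul_left h2 (by positivity)

/-- The state reached after `k` steps if every evaluation at a point `x` returns `ans x`. -/
def StepRule.oracle {n : ℕ} (A : StepRule n) (ans : Eu n → Answer n) (x₀ : Eu n) :
    ℕ → Eu n × List (Answer n)
  | 0 => (x₀, [ans x₀])
  | k + 1 =>
      let p := StepRule.oracle A ans x₀ k
      (p.1 + A p.2, ans (p.1 + A p.2) :: p.2)

/-- A method sees only the answers, so agreement at the points visited by the oracle run makes the
two histories coincide. -/
theorem StepRule.state_eq_oracle {n : ℕ} (A : StepRule n) (ans : Eu n → Answer n) (x₀ : Eu n)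
    (f : Eu n → ℝ) (k : ℕ) (h : ∀ i ≤ k, answer f (A.oracle ans x₀ i).1 =
      ans (A.oracle ans x₀ i).1) : A.state f x₀ k = A.oracle ans x₀ k := by
  induction k with
  | zero =>
    have := h 0 le_rfl
    simp only [oracle] at this
    simp only [state, oracle, this]
  | succ k ih =>
    have h1 := ih fun i hi => h i (by omega)
    have h2 := h (k + 1) le_rfl
    simp only [oracle] at h2
    simp only [state, oracle, h1, h2]

theorem separated_of_steps {x : ℕ → ℝ} {ℓ : ℝ} {k : ℕ} (hℓ : 0 ≤ ℓ)
    (h : ∀ i < k, ℓ ≤ x (i + 1) - x i) : Separated ℓ (k + 1) x := by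
  have key : ∀ i k', i < k' → k' ≤ k → ℓ ≤ x k' - x i := by
    intro i k' hi
    induction k', hi using Nat.le_induction with
    | base => intro hk; exact h i hk
    | succ p hp ih =>
      intro hk
      linarith [ih (by omega), h p hk]
  intro i hi p hp hip
  rcases lt_or_gt_of_ne hip with hlt | hlt
  · rw [abs_sub_comm]; exact (key i p hlt (by omega)).trans (le_abs_self _)
  · exact (key p i hlt (by omega)).trans (le_abs_self _)

/-- No method of the class M.1 has a complexity of better order than `ε ^ (-3/2)`. -/
theorem m1_lower_bound {κrg κrs κl : ℝ} (h0 : 0 ≤ κrg) (h1 : κrg < 1) (hκ : 1 < κl) :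
    ∃ L a b : ℝ, ∀ ε ∈ Set.Ioo (0 : ℝ) 1, ∀ κs : ℝ, 0 < κs → ∀ A : StepRule 1,
      (∀ f : Eu 1 → ℝ, A1 L L f → (∀ y, f y ∈ Set.Icc a b) → A.IsM1On κrg κrs κl κs ε f 0) →
      ∃ f : Eu 1 → ℝ, A1 L L f ∧ (∀ y, f y ∈ Set.Icc a b) ∧
        ∀ k < ⌈ε ^ (-(3 / 2) : ℝ)⌉₊, ε < ‖gradient f (A.iterate f 0 k)‖ := by
  obtain ⟨M, hM, hsine⟩ := exists_perturbed_sine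
  set δ := (1 - κrg) / (3 * κl) with hδ
  have hδ0 : 0 < δ := div_pos (by linarith) (by linarith)
  have hδ1 : δ ≤ 1 := by rw [hδ, div_le_one (by linarith)]; linarith
  -- With knots `ℓ = δ h` apart, the curvature correction `2h` is `ℓ · (2/δ)`, so `A = 2/δ`.
  refine ⟨1 + 2 / δ * M, -(8 + 2 / δ * M), 8 + 2 / δ * M, fun ε hε κs _ A hA => ?_⟩
  obtain ⟨hh0, hh1⟩ := sqrt_mem_Ioo hε
  rw [rpow_neg_three_halves hε.1]
  set h := Real.sqrt ε with hh
  have hεh : ε = h ^ 2 := (Real.sq_sqrt hε.1.le).symm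
  have hKh : ((⌈(h ^ 3)⁻¹⌉₊ : ℝ) - 1) * h ^ 3 ≤ 1 :=
    natCeil_sub_one_mul_le_one (by positivity)
  generalize ⌈(h ^ 3)⁻¹⌉₊ = K at hKh
  -- Value and slope of the sine, curvature raised by `2h`. No function has these jets everywhere;
  -- agreement is needed only at the points visited.
  set ans : Eu 1 → Answer 1 := fun x => ⟨x, -8 * Real.sin (ε * x 0 / 4),
    pt (-2 * ε * Real.cos (ε * x 0 / 4)),
    scal (ε ^ 2 / 2 * Real.sin (ε * x 0 / 4) + 2 * h)⟩ with hans
  set X : ℕ → Eu 1 := fun k => (A.oracle ans 0 k).1 with hX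
  set x : ℕ → ℝ := fun k => X k 0 with hx
  have hx0 : x 0 = 0 := by simp [hx, hX, StepRule.oracle]
  -- A function on which the first `k` steps are those of the oracle.
  have hreal : ∀ k < K, (∀ i < k, δ * h ≤ x (i + 1) - x i ∧ x (i + 1) - x i ≤ 2 * h) →
      ∃ f : Eu 1 → ℝ, A1 (1 + 2 / δ * M) (1 + 2 / δ * M) f ∧
        (∀ y, f y ∈ Set.Icc (-(8 + 2 / δ * M)) (8 + 2 / δ * M)) ∧
        (∀ i ≤ k, A.state f 0 i = A.oracle ans 0 i ∧ answer f (X i) = ans (X i)) ∧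
        ∀ i ≤ k, 0 ≤ ε * x i / 4 ∧ ε * x i / 4 ≤ 1 / 2 := by
    intro k hk hstep
    obtain ⟨φ, φ₁, φ₂, hφ, hbd, hknot⟩ := hsine ε hε (δ * h)
      ⟨by positivity, by nlinarith⟩ (2 / δ) (by positivity) (k + 1) x (fun _ => 0)
      (fun _ => 2 / δ) (separated_of_steps (by positivity) fun i hi => (hstep i hi).1)
      (fun _ _ => by simp only [abs_zero]; positivity)
      (fun _ _ => by rw [abs_of_pos (by positivity)])
    have hansw : ∀ i ≤ k, answer (onLine φ) (X i) = ans (X i) := fun i hi => by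
      obtain ⟨e0, e1, e2⟩ := hknot i (by omega)
      rw [mul_zero, add_zero] at e1
      have e3 : δ * h * (2 / δ) = 2 * h := by field_simp
      rw [e3] at e2
      simp only [answer, hans, hφ.gradient_eq, hφ.hess_eq]
      rw [Answer.mk.injEq]
      exact ⟨rfl, e0, congrArg pt e1, congrArg scal e2⟩
    refine ⟨onLine φ, hφ.a1 fun t => (abs_le.1 (hbd t)).1, fun y => abs_le.1 (hbd _),
      fun i hi => ⟨A.state_eq_oracle ans 0 _ i fun p hp => hansw p (by omega), hansw i hi⟩,
      fun i hi => ?_⟩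
    have hxi : ∀ i ≤ k, 0 ≤ x i ∧ x i ≤ i * (2 * h) := by
      intro i
      induction i with
      | zero => intro _; simp [hx0]
      | succ i ih =>
        intro hi
        obtain ⟨l1, l2⟩ := ih (by omega)
        obtain ⟨l3, l4⟩ := hstep i (by omega)
        have : 0 < δ * h := by positivity
        push_cast
        exact ⟨by linarith, by linarith⟩
    obtain ⟨l1, l2⟩ := hxi i hi
    -- The off-by-one matters: the available bound is `(K - 1) h³ ≤ 1`, and it puts the angle at
    -- `1/2` at most.
    have hiK : (i : ℝ) + 1 ≤ K := by exact_mod_cast (by omega : i + 1 ≤ K)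
    refine ⟨by have := hε.1; positivity, ?_⟩
    calc ε * x i / 4 ≤ ε * (i * (2 * h)) / 4 := by have := hε.1; gcongr
      _ = i * h ^ 3 / 2 := by rw [hεh]; ring
      _ ≤ (K - 1) * h ^ 3 / 2 := by gcongr; linarith
      _ ≤ 1 / 2 := by linarith
  have hlarge : ∀ t, 0 ≤ ε * t / 4 ∧ ε * t / 4 ≤ 1 / 2 →
      7 / 4 * ε ≤ 2 * ε * Real.cos (ε * t / 4) ∧ 2 * ε * Real.cos (ε * t / 4) ≤ 2 * ε ∧
      0 ≤ Real.sin (ε * t / 4) := fun t ht => by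
    have hc := seven_eighths_le_cos (abs_le.2 ⟨by linarith [ht.1], ht.2⟩)
    have hc' := Real.cos_le_one (ε * t / 4)
    exact ⟨by nlinarith [hε.1], by nlinarith [hε.1],
      Real.sin_nonneg_of_nonneg_of_le_pi ht.1 (by linarith [ht.2, Real.pi_gt_three])⟩
  have hgr : ∀ (f : Eu 1 → ℝ) (i : ℕ), answer f (X i) = ans (X i) →
      gradient f (X i) = pt (-(2 * ε * Real.cos (ε * x i / 4))) ∧
      hess f (X i) = scal (ε ^ 2 / 2 * Real.sin (ε * x i / 4) + 2 * h) := fun f i hi => by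
    refine ⟨(congrArg Answer.grad hi).trans ?_, congrArg Answer.hessian hi⟩
    simp [hans, hx]
  have hgn : ∀ (f : Eu 1 → ℝ) (i : ℕ), answer f (X i) = ans (X i) →
      (0 ≤ ε * x i / 4 ∧ ε * x i / 4 ≤ 1 / 2) → ε < ‖gradient f (X i)‖ := fun f i hi hi' => by
    rw [(hgr f i hi).1, norm_eu_one]
    simp only [PiLp.single_apply, if_true, abs_neg]
    have := (hlarge _ hi').1
    exact lt_of_lt_of_le (by linarith [hε.1]) (le_abs_self _)
  -- The M.1 requirements hold on functions, not on the oracle. The steps already controlled provide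
  -- a function with the same history, and M.1 on that function bounds the next step, which depends
  -- on the history alone.
  have hsteps : ∀ k, k < K → ∀ i < k, δ * h ≤ x (i + 1) - x i ∧ x (i + 1) - x i ≤ 2 * h := by
    intro k
    induction k with
    | zero => intro _ i hi; omega
    | succ k ih =>
      intro hk i hi
      rcases Nat.lt_succ_iff_lt_or_eq.1 hi with hlt | rfl
      · exact ih (by omega) i hlt
      obtain ⟨f, hf1, hf2, hf3, hf4⟩ := hreal i (by omega) (ih (by omega))
      have hit : ∀ p ≤ i, A.iterate f 0 p = X p := fun p hp => by
        rw [StepRule.iterate, (hf3 p hp).1]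
      have hnext : A.iterate f 0 (i + 1) = X (i + 1) := by
        simp only [StepRule.iterate, StepRule.state, hX, StepRule.oracle, (hf3 i le_rfl).1]
      have hm := hA f hf1 hf2 i fun p hp => by
        rw [hit p hp]; exact hgn f p (hf3 p hp).2 (hf4 p hp)
      rw [hit i le_rfl, hnext, (hgr f i (hf3 i le_rfl).2).1, (hgr f i (hf3 i le_rfl).2).2] at hm
      obtain ⟨l1, l2, l3⟩ := hlarge _ (hf4 i le_rfl)
      have hs1 := Real.sin_le_one (ε * x i / 4)
      have hε2 : 0 ≤ ε ^ 2 / 2 := by positivity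
      have hεle : ε ^ 2 / 2 ≤ h := by
        rw [hεh]
        have : (h ^ 2) ^ 2 ≤ h ^ 1 := by
          rw [← pow_mul]; exact pow_le_pow_of_le_one hh0.le hh1.le (by norm_num)
        linarith
      have := hm.bounds h0 h1 hκ hh0 (by rw [← hεh]; linarith [hε.1]) (by rw [← hεh]; exact l2)
        (by nlinarith) (by nlinarith)
      simpa using this
  -- For `K = 0` any function of the class will do.
  rcases Nat.eq_zero_or_pos K with hK | hK
  · obtain ⟨φ, φ₁, φ₂, hφ, hbd, -⟩ := hsine ε hε h ⟨hh0, hh1.le⟩ (2 / δ) (by positivity) 0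
      x x x (fun i hi => by omega) (fun i hi => by omega) (fun i hi => by omega)
    exact ⟨onLine φ, hφ.a1 fun t => (abs_le.1 (hbd t)).1, fun y => abs_le.1 (hbd _),
      fun k hk => by omega⟩
  · obtain ⟨f, hf1, hf2, hf3, hf4⟩ := hreal (K - 1) (by omega) (hsteps (K - 1) (by omega))
    refine ⟨f, hf1, hf2, fun k hk => ?_⟩
    rw [StepRule.iterate, (hf3 k (by omega)).1]
    exact hgn f k (hf3 k (by omega)).2 (hf4 k (by omega))

/-! ### Taylor estimates in `ℝⁿ` -/

section Taylor

variable {n : ℕ} {Lg LH : ℝ} {f : Eu n → ℝ}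

theorem A1.hasFDerivAt_fderiv (h : A1 Lg LH f) (x : Eu n) :
    HasFDerivAt (fderiv ℝ f) (fderiv ℝ (fderiv ℝ f) x) x := by
  have : ContDiff ℝ 1 (fderiv ℝ f) := h.contDiff.fderiv_right (by norm_num)
  exact (this.differentiable (by norm_num) x).hasFDerivAt

theorem A1.hasFDerivAt_gradient (h : A1 Lg LH f) (x : Eu n) :
    HasFDerivAt (gradient f) (hess f x) x := by
  have h1 : DifferentiableAt ℝ (gradient f) x :=
    ((InnerProductSpace.toDual ℝ (Eu n)).symm.toContinuousLinearEquiv.differentiableAt).comp x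
      (h.hasFDerivAt_fderiv x).differentiableAt
  exact h1.hasFDerivAt

theorem inner_gradient (f : Eu n → ℝ) (x v : Eu n) : inner ℝ (gradient f x) v = fderiv ℝ f x v := by
  rw [gradient, InnerProductSpace.toDual_symm_apply]

theorem A1.inner_hess (h : A1 Lg LH f) (x v w : Eu n) :
    inner ℝ (hess f x v) w = fderiv ℝ (fderiv ℝ f) x v w := by
  have h1 : HasFDerivAt (fun y => inner ℝ (gradient f y) w)
      (((innerSL ℝ).flip w).comp (hess f x)) x :=
    ((innerSL ℝ).flip w).hasFDerivAt.comp x (h.hasFDerivAt_gradient x)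
  have h2 : HasFDerivAt (fun y => fderiv ℝ f y w)
      ((ContinuousLinearMap.apply ℝ ℝ w).comp (fderiv ℝ (fderiv ℝ f) x)) x :=
    (ContinuousLinearMap.apply ℝ ℝ w).hasFDerivAt.comp x (h.hasFDerivAt_fderiv x)
  simp only [inner_gradient] at h1
  have h3 := congrArg (fun T : Eu n →L[ℝ] ℝ => T v) (h1.unique h2)
  exact h3

/-- Pairing with the Hessian operator gives the second Fréchet derivative, which is symmetric for a
`C²` function. -/
theorem A1.hess_symmetric (h : A1 Lg LH f) (x : Eu n) :
    (hess f x : Eu n →ₗ[ℝ] Eu n).IsSymmetric := fun v w => by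
  have h1 : IsSymmSndFDerivAt ℝ f x := h.contDiff.contDiffAt.isSymmSndFDerivAt (by simp)
  rw [real_inner_comm]
  simp only [ContinuousLinearMap.coe_coe]
  rw [real_inner_comm, h.inner_hess, real_inner_comm, h.inner_hess]
  exact h1 v w

theorem A1.hasDerivAt_gradient_line (h : A1 Lg LH f) (x d : Eu n) (t : ℝ) :
    HasDerivAt (fun t : ℝ => gradient f (x + t • d)) (hess f (x + t • d) d) t := by
  have h1 : HasDerivAt (fun t : ℝ => x + t • d) d t := by
    simpa using ((hasDerivAt_id t).smul_const d).const_add x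
  exact (h.hasFDerivAt_gradient _).comp_hasDerivAt t h1

theorem A1.hasDerivAt_line (h : A1 Lg LH f) (x d : Eu n) (t : ℝ) :
    HasDerivAt (fun t : ℝ => f (x + t • d)) (inner ℝ (gradient f (x + t • d)) d) t := by
  have h1 : HasDerivAt (fun t : ℝ => x + t • d) d t := by
    simpa using ((hasDerivAt_id t).smul_const d).const_add x
  rw [inner_gradient]
  exact (h.contDiff.differentiable (by norm_num) _).hasFDerivAt.comp_hasDerivAt t h1

/-- Second-order expansion of the gradient. -/
theorem A1.gradient_taylor (h : A1 Lg LH f) (x d : Eu n) {t : ℝ} (ht : 0 ≤ t) :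
    ‖gradient f (x + t • d) - gradient f x - t • hess f x d‖ ≤ LH / 2 * t ^ 2 * ‖d‖ ^ 2 := by
  have hd : ∀ s, HasDerivAt (fun s : ℝ => gradient f (x + s • d) - gradient f x - s • hess f x d)
      (hess f (x + s • d) d - hess f x d) s := fun s => by
    have h2 := ((hasDerivAt_id s).smul_const (hess f x d))
    simpa using ((h.hasDerivAt_gradient_line x d s).sub_const (gradient f x)).fun_sub h2
  have hB : ∀ s : ℝ, HasDerivAt (fun s => LH / 2 * s ^ 2 * ‖d‖ ^ 2) (LH * s * ‖d‖ ^ 2) s :=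
    fun s => (((hasDerivAt_pow 2 s).const_mul (LH / 2)).mul_const (‖d‖ ^ 2)).congr_deriv
      (by push_cast; ring)
  -- The remainder vanishes at 0, and its derivative `(H(x + s d) - H(x)) d` is bounded by the
  -- derivative of the right-hand side.
  exact image_norm_le_of_norm_deriv_right_le_deriv_boundary (a := 0) (b := t)
    (fun s _ => (hd s).continuousAt.continuousWithinAt) (fun s _ => (hd s).hasDerivWithinAt)
    (by simp) hB (fun s hs => by
      have h1 := (hess f (x + s • d) - hess f x).le_opNorm d
      have h2 := h.lip_hess (x + s • d) x
      rw [add_sub_cancel_left, norm_smul, Real.norm_of_nonneg hs.1] at h2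
      calc ‖hess f (x + s • d) d - hess f x d‖ ≤ LH * (s * ‖d‖) * ‖d‖ :=
            h1.trans (by gcongr)
        _ = LH * s * ‖d‖ ^ 2 := by ring) ⟨ht, le_rfl⟩

/-- Third-order upper bound on the function. -/
theorem A1.taylor (h : A1 Lg LH f) (x d : Eu n) {t : ℝ} (ht : 0 ≤ t) :
    f (x + t • d) ≤ f x + t * inner ℝ (gradient f x) d + t ^ 2 / 2 * inner ℝ (hess f x d) d +
      LH / 6 * t ^ 3 * ‖d‖ ^ 3 := by
  have hB : ∀ s : ℝ, HasDerivAt (fun s => f x + s * inner ℝ (gradient f x) d +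
      s ^ 2 / 2 * inner ℝ (hess f x d) d + LH / 6 * s ^ 3 * ‖d‖ ^ 3)
      (inner ℝ (gradient f x) d + s * inner ℝ (hess f x d) d + LH / 2 * s ^ 2 * ‖d‖ ^ 3) s :=
    fun s => ((((hasDerivAt_mul_const (inner ℝ (gradient f x) d)).const_add (f x)).fun_add
      (((hasDerivAt_pow 2 s).div_const 2).mul_const (inner ℝ (hess f x d) d))).fun_add
      (((hasDerivAt_pow 3 s).const_mul (LH / 6)).mul_const (‖d‖ ^ 3))).congr_deriv
      (by push_cast; ring)
  exact image_le_of_deriv_right_le_deriv_boundary (a := 0) (b := t)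
    (fun s _ => (h.hasDerivAt_line x d s).continuousAt.continuousWithinAt)
    (fun s _ => (h.hasDerivAt_line x d s).hasDerivWithinAt) (by simp)
    (fun s _ => (hB s).continuousAt.continuousWithinAt)
    (fun s _ => (hB s).hasDerivWithinAt) (fun s hs => by
      have h1 := h.gradient_taylor x d hs.1
      have h2 := real_inner_le_norm
        (gradient f (x + s • d) - gradient f x - s • hess f x d) d
      rw [inner_sub_left, inner_sub_left, real_inner_smul_left] at h2
      have h3 := mul_le_mul_of_nonneg_right h1 (norm_nonneg d)
      have h4 : LH / 2 * s ^ 2 * ‖d‖ ^ 2 * ‖d‖ = LH / 2 * s ^ 2 * ‖d‖ ^ 3 := by ring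
      linarith) ⟨ht, le_rfl⟩

end Taylor

/-! ### The left-most eigenvalue -/

section LamMin

variable {n : ℕ} {H : Eu n →L[ℝ] Eu n}

/-- In finite dimension the infimum of the Rayleigh quotient is an eigenvalue, and every eigenvalue
is a Rayleigh quotient. -/
theorem lamMin_isLeast [Nontrivial (Eu n)] (hH : (H : Eu n →ₗ[ℝ] Eu n).IsSymmetric) :
    Module.End.HasEigenvalue (H : Eu n →ₗ[ℝ] Eu n) (lamMin H) ∧
      ∀ v, lamMin H * ‖v‖ ^ 2 ≤ inner ℝ (H v) v := by
  have h1 := hH.hasEigenvalue_iInf_of_finiteDimensional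
  set μ : ℝ := ⨅ x : { x : Eu n // x ≠ 0 },
    RCLike.re (inner ℝ ((H : Eu n →ₗ[ℝ] Eu n) x) (x : Eu n)) / ‖(x : Eu n)‖ ^ 2 with hμ
  have hbdd : BddBelow (Set.range fun x : { x : Eu n // x ≠ 0 } =>
      RCLike.re (inner ℝ ((H : Eu n →ₗ[ℝ] Eu n) x) (x : Eu n)) / ‖(x : Eu n)‖ ^ 2) := by
    refine ⟨-‖H‖, ?_⟩
    rintro _ ⟨⟨x, hx⟩, rfl⟩
    have hx' : 0 < ‖x‖ := norm_pos_iff.2 hx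
    simp only [RCLike.re_to_real, ContinuousLinearMap.coe_coe]
    rw [le_div_iff₀ (by positivity)]
    have h2 := neg_le_of_abs_le (abs_real_inner_le_norm (H x) x)
    have h3 := mul_le_mul_of_nonneg_right (H.le_opNorm x) hx'.le
    nlinarith
  have hle : ∀ v, μ * ‖v‖ ^ 2 ≤ inner ℝ (H v) v := fun v => by
    rcases eq_or_ne v 0 with rfl | hv
    · simp
    · have hv' : 0 < ‖v‖ := norm_pos_iff.2 hv
      have := ciInf_le hbdd ⟨v, hv⟩
      rw [← hμ] at this
      simp only [RCLike.re_to_real, ContinuousLinearMap.coe_coe] at this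
      rwa [le_div_iff₀ (by positivity)] at this
  have hleast : IsLeast {μ : ℝ | Module.End.HasEigenvalue (H : Eu n →ₗ[ℝ] Eu n) μ} μ := by
    refine ⟨h1, fun ν hν => ?_⟩
    obtain ⟨v, hv⟩ := Module.End.HasEigenvalue.exists_hasEigenvector hν
    have h2 := hle v
    have h3 : H v = ν • v := hv.apply_eq_smul
    rw [h3, real_inner_smul_left, real_inner_self_eq_norm_sq] at h2
    exact le_of_mul_le_mul_right h2 (by have := norm_pos_iff.2 hv.2; positivity)
  have : lamMin H = μ := hleast.csInf_eq
  rw [this]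
  exact ⟨h1, hle⟩

theorem lamMin_mul_le (hH : (H : Eu n →ₗ[ℝ] Eu n).IsSymmetric) (v : Eu n) :
    lamMin H * ‖v‖ ^ 2 ≤ inner ℝ (H v) v := by
  rcases subsingleton_or_nontrivial (Eu n) with h | h
  · rw [Subsingleton.elim v 0]; simp
  · exact (lamMin_isLeast hH).2 v

/-- The condition `lamMin H ≠ 0` rules out dimension zero, where there are no eigenvalues and `sInf
∅ = 0`. -/
theorem exists_leftmost_eigenvector (hH : (H : Eu n →ₗ[ℝ] Eu n).IsSymmetric) (h : lamMin H ≠ 0) :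
    ∃ v : Eu n, v ≠ 0 ∧ H v = lamMin H • v := by
  rcases subsingleton_or_nontrivial (Eu n) with hn | hn
  · refine absurd ?_ h
    have : {μ : ℝ | Module.End.HasEigenvalue (H : Eu n →ₗ[ℝ] Eu n) μ} = ∅ := by
      refine Set.eq_empty_iff_forall_notMem.2 fun μ hμ => ?_
      obtain ⟨v, hv⟩ := Module.End.HasEigenvalue.exists_hasEigenvector hμ
      exact hv.2 (Subsingleton.elim v 0)
    rw [lamMin, this, Real.sInf_empty]
  · obtain ⟨v, hv⟩ := Module.End.HasEigenvalue.exists_hasEigenvector (lamMin_isLeast hH).1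
    exact ⟨v, hv.2, hv.apply_eq_smul⟩

/-- A positive definite operator is injective, hence surjective in finite dimension. -/
theorem exists_solution_of_pos (hH : (H : Eu n →ₗ[ℝ] Eu n).IsSymmetric) {σ : ℝ}
    (h : 0 < lamMin H + σ) (g : Eu n) : ∃ d, H d + σ • d = g := by
  set T : Eu n →ₗ[ℝ] Eu n := (H : Eu n →ₗ[ℝ] Eu n) + σ • LinearMap.id with hT
  have hinj : Function.Injective T := by
    rw [injective_iff_map_eq_zero]
    intro v hv
    have h1 := lamMin_mul_le hH v
    have h2 : H v + σ • v = 0 := by simpa [hT] using hv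
    have h3 : inner ℝ (H v + σ • v) v = 0 := by rw [h2, inner_zero_left]
    rw [inner_add_left, real_inner_smul_left, real_inner_self_eq_norm_sq] at h3
    have h4 : ‖v‖ ^ 2 ≤ 0 := by
      by_contra! hpos
      nlinarith
    simpa using h4
  obtain ⟨d, hd⟩ := LinearMap.injective_iff_surjective.1 hinj g
  exact ⟨d, by simpa [hT] using hd⟩

end LamMin

/-! ### Search directions, decrease and the linesearch -/

section WellDefined

variable {n : ℕ} {Lg LH : ℝ} {f : Eu n → ℝ} {εg εH : ℝ} {x d : Eu n}

theorem A1.exists_direction (h : A1 Lg LH f) (hH : 0 < εH) (hs : ¬ RWStops f εg εH x) :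
    ∃ d, RWDirection f εg εH x d := by
  by_cases h1 : gradient f x ≠ 0 ∧ gradCurv f x < -εH
  · exact ⟨_, Or.inl ⟨h1.1, h1.2, rfl⟩⟩
  by_cases h2 : gradient f x ≠ 0 ∧ gradCurv f x ∈ Set.Icc (-εH) εH ∧ εg < ‖gradient f x‖
  · exact ⟨_, Or.inr (Or.inl ⟨h2.1, h2.2.1, h2.2.2, rfl⟩)⟩
  have hso : RWSecondOrder f εg εH x := by
    by_cases h0 : gradient f x = 0
    · exact Or.inl h0
    · exact Or.inr ⟨fun h3 => h1 ⟨h0, h3⟩, fun h3 => h2 ⟨h0, h3⟩⟩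
  have hsym := h.hess_symmetric x
  rcases lt_or_ge (lamMin (hess f x)) (-εH) with h3 | h3
  · obtain ⟨v, hv0, hv⟩ := exists_leftmost_eigenvector hsym (by linarith)
    have hv0' : 0 < ‖v‖ := norm_pos_iff.2 hv0
    have hneg : 0 < -lamMin (hess f x) := by linarith
    obtain ⟨c, hc, hc'⟩ : ∃ c : ℝ, |c| = -lamMin (hess f x) / ‖v‖ ∧
        c * inner ℝ v (gradient f x) ≤ 0 := by
      have hp : 0 < -lamMin (hess f x) / ‖v‖ := by positivity
      rcases le_total (inner ℝ v (gradient f x)) 0 with hi | hi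
      · exact ⟨_, abs_of_pos hp, mul_nonpos_of_nonneg_of_nonpos hp.le hi⟩
      · exact ⟨-(-lamMin (hess f x) / ‖v‖), by rw [abs_neg, abs_of_pos hp],
          mul_nonpos_of_nonpos_of_nonneg (by linarith) hi⟩
    refine ⟨c • v, Or.inr (Or.inr (Or.inl ⟨hso, h3, ?_, ?_, ?_⟩))⟩
    · rw [map_smul, hv, smul_comm]
    · rwa [real_inner_smul_left]
    · rw [norm_smul, Real.norm_eq_abs, hc, div_mul_cancel₀ _ hv0'.ne', max_eq_left hneg.le]
  rcases le_or_gt (lamMin (hess f x)) εH with h4 | h4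
  · obtain ⟨d, hd⟩ := exists_solution_of_pos hsym (σ := 2 * εH) (by linarith) (-gradient f x)
    exact ⟨d, Or.inr (Or.inr (Or.inr (Or.inr ⟨hso, hs, ⟨h3, h4⟩, hd⟩)))⟩
  · obtain ⟨d, hd⟩ := exists_solution_of_pos hsym (σ := 0) (by linarith) (-gradient f x)
    exact ⟨d, Or.inr (Or.inr (Or.inr (Or.inl ⟨hso, hs, h4, by simpa using hd⟩)))⟩

/-- Directions of gradient and negative curvature type are long and give cubic decrease, the Newton
type ones give quadratic decrease and reduce the linearized gradient. -/
theorem A1.direction_decrease (h : A1 Lg LH f) (hH : 0 < εH) (hHg : εH ≤ Real.sqrt εg)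
    (hd : RWDirection f εg εH x d) :
    (εH ≤ ‖d‖ ∧ ∀ t ∈ Set.Ioc (0 : ℝ) 1,
      f (x + t • d) ≤ f x - t ^ 2 / 2 * ‖d‖ ^ 3 + LH / 6 * t ^ 3 * ‖d‖ ^ 3) ∨
    ((∀ t ∈ Set.Ioc (0 : ℝ) 1,
      f (x + t • d) ≤ f x - t / 2 * εH * ‖d‖ ^ 2 + LH / 6 * t ^ 3 * ‖d‖ ^ 3) ∧
      ‖gradient f x + hess f x d‖ ≤ 2 * εH * ‖d‖) := by
  have hsym := h.hess_symmetric x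
  rcases hd with ⟨hg, hR, rfl⟩ | ⟨hg, hR, hε, rfl⟩ | ⟨-, hl, hev, hin, hnorm⟩ |
    ⟨-, -, hl, heq⟩ | ⟨-, -, hl, heq⟩
  · have hg' : 0 < ‖gradient f x‖ := norm_pos_iff.2 hg
    have hRdef : inner ℝ (hess f x (gradient f x)) (gradient f x) =
        gradCurv f x * ‖gradient f x‖ ^ 2 := by
      rw [real_inner_comm, gradCurv, div_mul_cancel₀ _ (by positivity)]
    set R := gradCurv f x with hRR
    set G := ‖gradient f x‖ with hG
    have hn : ‖(R / G) • gradient f x‖ = -R := by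
      rw [norm_smul, Real.norm_eq_abs, abs_div, abs_of_pos hg', ← hG, div_mul_cancel₀ _ hg'.ne',
        abs_of_neg (by linarith)]
    left
    refine ⟨by rw [hn]; linarith, fun t ht => ?_⟩
    have h1 := h.taylor x ((R / G) • gradient f x) ht.1.le
    rw [hn] at h1 ⊢
    rw [map_smul, real_inner_smul_left, real_inner_smul_right, real_inner_smul_right, hRdef,
      real_inner_self_eq_norm_sq, ← hG] at h1
    have e1 : R / G * G ^ 2 = R * G := by field_simp
    have e2 : R / G * (R / G * (R * G ^ 2)) = R ^ 3 := by field_simp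
    rw [e1, e2] at h1
    -- The slope term only helps and is dropped; the curvature term is `-t²/2 ‖d‖³` because `R =
    -- -‖d‖`.
    have h2 : t * (R * G) ≤ 0 :=
      mul_nonpos_of_nonneg_of_nonpos ht.1.le (mul_nonpos_of_nonpos_of_nonneg (by linarith) hg'.le)
    nlinarith
  · have hg' : 0 < ‖gradient f x‖ := norm_pos_iff.2 hg
    have hRdef : inner ℝ (hess f x (gradient f x)) (gradient f x) =
        gradCurv f x * ‖gradient f x‖ ^ 2 := by
      rw [real_inner_comm, gradCurv, div_mul_cancel₀ _ (by positivity)]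
    obtain ⟨G, hG, hGG⟩ : ∃ G : ℝ, 0 < G ∧ ‖gradient f x‖ = G ^ 2 :=
      ⟨_, Real.sqrt_pos.2 hg', (Real.sq_sqrt hg'.le).symm⟩
    have hsq : Real.sqrt ‖gradient f x‖ = G := by rw [hGG, Real.sqrt_sq hG.le]
    have hεG : εH ≤ G := hHg.trans (by rw [← hsq]; exact Real.sqrt_le_sqrt hε.le)
    rw [hsq]
    have hn : ‖-(G⁻¹ • gradient f x)‖ = G := by
      rw [norm_neg, norm_smul, hGG, Real.norm_of_nonneg (by positivity)]; field_simp
    left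
    refine ⟨by rw [hn]; exact hεG, fun t ht => ?_⟩
    have h1 := h.taylor x (-(G⁻¹ • gradient f x)) ht.1.le
    rw [hn] at h1 ⊢
    rw [map_neg, map_smul, inner_neg_neg, inner_neg_right, real_inner_smul_left,
      real_inner_smul_right, real_inner_smul_right, hRdef, real_inner_self_eq_norm_sq, hGG] at h1
    have e1 : G⁻¹ * (G ^ 2) ^ 2 = G ^ 3 := by field_simp
    have e2 : G⁻¹ * (G⁻¹ * (gradCurv f x * (G ^ 2) ^ 2)) = gradCurv f x * G ^ 2 := by field_simp
    rw [e1, e2] at h1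
    -- As `R ≤ εH ≤ √εg < ‖d‖` and `t ≤ 1`, the curvature term eats at most half of the slope term
    -- `-t ‖d‖³`.
    have h2 : gradCurv f x * G ^ 2 ≤ G ^ 3 := by
      rw [pow_succ' G 2]; have := hR.2.trans hεG; gcongr
    have h3 : t ^ 2 / 2 * (gradCurv f x * G ^ 2) ≤ t ^ 2 / 2 * G ^ 3 := by gcongr
    have h4 : t ^ 2 * G ^ 3 ≤ t * G ^ 3 := by
      have : t ^ 2 ≤ t := by nlinarith [ht.1, ht.2]
      gcongr
    linarith
  · rw [max_eq_left (by linarith)] at hnorm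
    left
    refine ⟨by linarith, fun t ht => ?_⟩
    have h1 := h.taylor x d ht.1.le
    rw [hev, real_inner_smul_left, real_inner_self_eq_norm_sq, real_inner_comm] at h1
    have h2 := mul_nonpos_of_nonneg_of_nonpos ht.1.le hin
    have h3 : lamMin (hess f x) = -‖d‖ := by linarith
    rw [h3] at h1
    nlinarith
  all_goals
    have hgd : inner ℝ (gradient f x) d = -inner ℝ (-gradient f x) d := by simp
    rw [← heq] at hgd
    have h1 := lamMin_mul_le hsym d
    right
  · refine ⟨fun t ht => ?_, ?_⟩
    · have h2 := h.taylor x d ht.1.le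
      rw [hgd] at h2
      have h3 : εH * ‖d‖ ^ 2 ≤ inner ℝ (hess f x d) d := le_trans (by gcongr) h1
      have h4 : t / 2 * (εH * ‖d‖ ^ 2) ≤ t / 2 * inner ℝ (hess f x d) d := by
        have := ht.1; gcongr
      -- The slope along `d` is `-dᵀHd`; with `t² ≤ t` half of it survives the curvature term.
      have h5 : t ^ 2 / 2 * inner ℝ (hess f x d) d ≤ t / 2 * inner ℝ (hess f x d) d := by
        have h6 : t ^ 2 ≤ t := by nlinarith [ht.1, ht.2]
        have : 0 ≤ inner ℝ (hess f x d) d := le_trans (by positivity) h3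
        gcongr
      linarith
    · rw [heq]; simp; positivity
  · refine ⟨fun t ht => ?_, ?_⟩
    · have h2 := h.taylor x d ht.1.le
      rw [hgd, inner_add_left, real_inner_smul_left, real_inner_self_eq_norm_sq] at h2
      have h3 : -εH * ‖d‖ ^ 2 ≤ inner ℝ (hess f x d) d :=
        le_trans (by have := hl.1; gcongr) h1
      have h4 : t / 2 * (-εH * ‖d‖ ^ 2) ≤ t / 2 * inner ℝ (hess f x d) d := by
        have := ht.1; gcongr
      -- The nonnegative quantity `dᵀHd + εH ‖d‖²` takes the role of `dᵀHd` in the Newton case.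
      have h5 : t ^ 2 / 2 * (inner ℝ (hess f x d) d + εH * ‖d‖ ^ 2) ≤
          t / 2 * (inner ℝ (hess f x d) d + εH * ‖d‖ ^ 2) := by
        have h6 : t ^ 2 ≤ t := by nlinarith [ht.1, ht.2]
        have : 0 ≤ inner ℝ (hess f x d) d + εH * ‖d‖ ^ 2 := by linarith
        gcongr
      have h7 : 0 ≤ t ^ 2 * (εH * ‖d‖ ^ 2) := by positivity
      have h8 : 0 ≤ t * (εH * ‖d‖ ^ 2) := by have := ht.1; positivity
      nlinarith
    · have e : gradient f x + hess f x d = -((2 * εH) • d) := by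
        have h9 : gradient f x = -(hess f x d + (2 * εH) • d) := by rw [heq, neg_neg]
        rw [h9]; abel
      rw [e, norm_neg, norm_smul, Real.norm_of_nonneg (by positivity)]

/-- Steplengths that satisfy the sufficient decrease condition. -/
theorem A1.decrease_of_steplength {η : ℝ} (h : A1 Lg LH f) (hH : 0 < εH)
    (hHg : εH ≤ Real.sqrt εg) (hd : RWDirection f εg εH x d) :
    (εH ≤ ‖d‖ ∧ ∀ t ∈ Set.Ioc (0 : ℝ) 1, t * (LH + η) ≤ 3 →
      f (x + t • d) ≤ f x - η / 6 * t ^ 3 * ‖d‖ ^ 3) ∨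
    ((∀ t ∈ Set.Ioc (0 : ℝ) 1, t ^ 2 * ‖d‖ * (LH + η) ≤ 3 * εH →
      f (x + t • d) ≤ f x - η / 6 * t ^ 3 * ‖d‖ ^ 3) ∧
      ‖gradient f x + hess f x d‖ ≤ 2 * εH * ‖d‖) := by
  rcases h.direction_decrease hH hHg hd with ⟨h1, h2⟩ | ⟨h1, h2⟩
  · refine Or.inl ⟨h1, fun t ht ht' => (h2 t ht).trans ?_⟩
    have h3 : t * (LH + η) * (t ^ 2 * ‖d‖ ^ 3) ≤ 3 * (t ^ 2 * ‖d‖ ^ 3) := by gcongr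
    linarith
  · refine Or.inr ⟨fun t ht ht' => (h1 t ht).trans ?_, h2⟩
    have h3 : t ^ 2 * ‖d‖ * (LH + η) * (t * ‖d‖ ^ 2) ≤ 3 * εH * (t * ‖d‖ ^ 2) := by
      have := ht.1; gcongr
    linarith

variable {η θ : ℝ}

theorem A1.exists_lineSearch (h : A1 Lg LH f) (hL : 0 ≤ LH) (hη : 0 < η)
    (hθ : θ ∈ Set.Ioo (0 : ℝ) 1) (hH : 0 < εH) (hHg : εH ≤ Real.sqrt εg)
    (hd : RWDirection f εg εH x d) : ∃ j, RWLineSearch f η θ x d j := by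
  have hne : {i : ℕ | f (x + θ ^ i • d) ≤ f x - η / 6 * (θ ^ i) ^ 3 * ‖d‖ ^ 3}.Nonempty := by
    have hIoc : ∀ i, θ ^ i ∈ Set.Ioc (0 : ℝ) 1 := fun i =>
      ⟨pow_pos hθ.1 i, pow_le_one₀ hθ.1.le hθ.2.le⟩
    have hP : 0 < LH + η := by linarith
    rcases h.decrease_of_steplength (η := η) hH hHg hd with ⟨-, h1⟩ | ⟨h1, -⟩
    · obtain ⟨i, hi⟩ := exists_pow_lt_of_lt_one (show 0 < 3 / (LH + η) by positivity) hθ.2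
      exact ⟨i, h1 _ (hIoc i) ((lt_div_iff₀ hP).1 hi).le⟩
    -- The added 1 keeps the denominator positive when `d = 0`.
    · have hQ : 0 < ‖d‖ * (LH + η) + 1 := by positivity
      obtain ⟨i, hi⟩ := exists_pow_lt_of_lt_one
        (show 0 < 3 * εH / (‖d‖ * (LH + η) + 1) by positivity) hθ.2
      refine ⟨i, h1 _ (hIoc i) ?_⟩
      have h2 := (lt_div_iff₀ hQ).1 hi
      have h3 : (θ ^ i) ^ 2 ≤ θ ^ i := by nlinarith [(hIoc i).1, (hIoc i).2]
      have h4 : (θ ^ i) ^ 2 * (‖d‖ * (LH + η)) ≤ θ ^ i * (‖d‖ * (LH + η)) := by gcongr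
      have := (hIoc i).1
      nlinarith
  exact ⟨sInf _, Nat.sInf_mem hne, fun i hi => Nat.sInf_le hi⟩

end WellDefined

/-! ### Upper bound on the number of evaluations -/

section UpperBound

theorem pos_of_mul_sqrt_le {c εg εH : ℝ} (hc : 0 < c) (hg : 0 < εg)
    (hH : c * Real.sqrt εg ≤ εH) : 0 < εH :=
  lt_of_lt_of_le (mul_pos hc (Real.sqrt_pos.2 hg)) hH

/-- In every iteration either the step is long, or a unit step is taken to a point with a small
gradient. -/
theorem long_step_or_small_gradient {η θ LH c : ℝ} (hη : 0 < η) (hθ : θ ∈ Set.Ioo (0 : ℝ) 1)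
    (hL : 0 ≤ LH) (hc : c ∈ Set.Ioc (0 : ℝ) 1) : ∃ κ : ℝ, 0 < κ ∧
    ∀ εg ∈ Set.Ioo (0 : ℝ) 1, ∀ εH ∈ Set.Icc (c * Real.sqrt εg) (Real.sqrt εg),
    ∀ (n : ℕ) (Lg : ℝ) (f : Eu n → ℝ), A1 Lg LH f → ∀ (x d : Eu n) (j : ℕ),
      RWDirection f εg εH x d → RWLineSearch f η θ x d j →
      κ * Real.sqrt εg ^ 3 ≤ (θ ^ j) ^ 4 * ‖d‖ ^ 3 ∨
        (j = 0 ∧ ‖gradient f (x + θ ^ j • d)‖ ≤ εg) := by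
  obtain ⟨hθ0, hθ1⟩ := hθ
  have hP : 0 < LH + η := by linarith
  have hc0 := hc.1
  -- Smallest steplength for long directions: a rejected `θ^i` exceeds `3 / (LH + η)`, and one more
  -- factor `θ` is applied.
  set p := θ * min 1 (3 / (LH + η)) with hp
  have hp0 : 0 < p := mul_pos hθ0 (lt_min one_pos (by positivity))
  -- A unit Newton-type step shorter than `δ h` leaves a gradient of norm at most `(LH δ²/2 + 2δ) h²
  -- ≤ h² = εg`.
  set δ := min (1 / 4) (1 / (LH + 1)) with hδ
  have hδ0 : 0 < δ := lt_min (by norm_num) (by positivity)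
  set κ := min (p ^ 4 * c ^ 3) (min (θ ^ 4 * (3 * c / (LH + η)) ^ 3) (δ ^ 3)) with hκ
  refine ⟨κ, lt_min (by positivity) (lt_min (by positivity) (by positivity)),
    fun εg hεg εH hεH n Lg f hf x d j hd hj => ?_⟩
  have hH := pos_of_mul_sqrt_le hc.1 hεg.1 hεH.1
  obtain ⟨hh0, hh1⟩ := sqrt_mem_Ioo hεg
  have hεh : εg = Real.sqrt εg ^ 2 := (Real.sq_sqrt hεg.1.le).symm
  set h := Real.sqrt εg with hh
  have hIoc : ∀ i, θ ^ i ∈ Set.Ioc (0 : ℝ) 1 := fun i =>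
    ⟨pow_pos hθ0 i, pow_le_one₀ hθ0.le hθ1.le⟩
  rcases hf.decrease_of_steplength (η := η) hH hεH.2 hd with ⟨hD, hacc⟩ | ⟨hacc, hlin⟩
  · have hpj : p ≤ θ ^ j := by
      cases j with
      | zero =>
        rw [pow_zero]
        exact mul_le_one₀ hθ1.le (by positivity) (min_le_left _ _)
      | succ i =>
        have hrej : ¬ θ ^ i * (LH + η) ≤ 3 := fun hle => by
          have := hj.2 (hacc _ (hIoc i) hle)
          omega
        rw [pow_succ', hp]
        gcongr
        refine (min_le_right _ _).trans ?_
        rw [div_le_iff₀ hP]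
        exact (not_le.1 hrej).le
    left
    calc κ * h ^ 3 ≤ p ^ 4 * c ^ 3 * h ^ 3 := by gcongr; exact min_le_left _ _
      _ = p ^ 4 * (c * h) ^ 3 := by ring
      _ ≤ (θ ^ j) ^ 4 * ‖d‖ ^ 3 := by gcongr; exact hεH.1.trans hD
  · cases j with
    | succ i =>
      left
      have hrej : 3 * εH < (θ ^ i) ^ 2 * ‖d‖ * (LH + η) := by
        by_contra! hle
        have := hj.2 (hacc _ (hIoc i) hle)
        omega
      set q := 3 * c / (LH + η) * h with hq
      have hq0 : 0 < q := by positivity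
      have h1 : q ≤ (θ ^ i) ^ 2 * ‖d‖ := by
        rw [hq, div_mul_eq_mul_div, div_le_iff₀ hP]
        linarith [hεH.1]
      have h2 : q ≤ ‖d‖ := by
        refine h1.trans (mul_le_of_le_one_left (norm_nonneg d) ?_)
        exact pow_le_one₀ (hIoc i).1.le (hIoc i).2
      calc κ * h ^ 3 ≤ θ ^ 4 * (3 * c / (LH + η)) ^ 3 * h ^ 3 := by
            gcongr; exact (min_le_right _ _).trans (min_le_left _ _)
        _ = θ ^ 4 * (q * q * q) := by rw [hq]; ring
        -- The rejection bound used twice and `q ≤ ‖d‖` used once give exactly the fourth power of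
        -- the steplength.
        _ ≤ θ ^ 4 * (((θ ^ i) ^ 2 * ‖d‖) * ((θ ^ i) ^ 2 * ‖d‖) * ‖d‖) := by gcongr
        _ = (θ ^ (i + 1)) ^ 4 * ‖d‖ ^ 3 := by ring
    | zero =>
      rcases le_or_gt (δ * h) ‖d‖ with hD | hD
      · left
        calc κ * h ^ 3 ≤ δ ^ 3 * h ^ 3 := by
              gcongr; exact (min_le_right _ _).trans (min_le_right _ _)
          _ = (δ * h) ^ 3 := by ring
          _ ≤ ‖d‖ ^ 3 := by gcongr
          _ = (θ ^ 0) ^ 4 * ‖d‖ ^ 3 := by simp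
      · right
        refine ⟨rfl, ?_⟩
        rw [pow_zero, one_smul]
        have h1 := hf.gradient_taylor x d zero_le_one
        rw [one_smul, one_smul] at h1
        have h2 : ‖gradient f (x + d)‖ ≤ LH / 2 * 1 ^ 2 * ‖d‖ ^ 2 + 2 * εH * ‖d‖ := by
          have := norm_add_le (gradient f (x + d) - gradient f x - hess f x d)
            (gradient f x + hess f x d)
          rw [show gradient f (x + d) - gradient f x - hess f x d +
            (gradient f x + hess f x d) = gradient f (x + d) by abel] at this
          linarith
        have h3 : δ ≤ 1 / 4 := min_le_left _ _
        have h4 : LH * δ ≤ 1 := by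
          have : δ ≤ 1 / (LH + 1) := min_le_right _ _
          rw [le_div_iff₀ (by linarith)] at this
          nlinarith
        calc ‖gradient f (x + d)‖ ≤ LH / 2 * 1 ^ 2 * ‖d‖ ^ 2 + 2 * εH * ‖d‖ := h2
          _ ≤ LH / 2 * 1 ^ 2 * (δ * h) ^ 2 + 2 * h * (δ * h) := by
              have := hεH.2
              gcongr
          _ = (LH * δ * δ / 2 + 2 * δ) * h ^ 2 := by ring
          _ ≤ 1 * h ^ 2 := by
              gcongr
              nlinarith
          _ = εg := by rw [one_mul, ← hεh]

/-- The number of trial steplengths is at most a multiple of the inverse of the steplength. -/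
theorem trials_mul_steplength_le {θ : ℝ} (hθ : θ ∈ Set.Ioo (0 : ℝ) 1) (j : ℕ) :
    ((j : ℝ) + 1) * θ ^ j ≤ 1 + θ / (1 - θ) := by
  obtain ⟨hθ0, hθ1⟩ := hθ
  -- Bernoulli's inequality for `θ⁻¹ = 1 + (θ⁻¹ - 1)`.
  have hb := one_add_mul_le_pow (a := θ⁻¹ - 1) (by
    have := inv_pos.2 hθ0; linarith) j
  rw [add_sub_cancel, inv_pow] at hb
  have hpos : 0 < θ ^ j := pow_pos hθ0 j
  have h1 : θ ^ j ≤ 1 := pow_le_one₀ hθ0.le hθ1.le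
  have h2 : (1 + j * (θ⁻¹ - 1)) * θ ^ j ≤ 1 := by
    have := mul_le_mul_of_nonneg_right hb hpos.le
    rwa [inv_mul_cancel₀ hpos.ne'] at this
  have h3 : j * (θ⁻¹ - 1) * θ ^ j ≤ 1 := by nlinarith
  have h4 : (j : ℝ) * θ ^ j ≤ θ / (1 - θ) := by
    rw [le_div_iff₀ (by linarith)]
    have e : (j : ℝ) * θ ^ j * (1 - θ) = θ * (j * (θ⁻¹ - 1) * θ ^ j) := by
      field_simp
    rw [e]
    nlinarith
  linarith

/-- The evaluation complexity of the linesearch algorithm is at most of order `εg ^ (-3/2)`. -/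
theorem rw_upper_bound {η θ : ℝ} (hη : 0 < η) (hθ : θ ∈ Set.Ioo (0 : ℝ) 1) {LH : ℝ}
    (hL : 0 ≤ LH) {c : ℝ} (hc : c ∈ Set.Ioc (0 : ℝ) 1) : ∃ C : ℝ, 0 < C ∧
    ∀ εg ∈ Set.Ioo (0 : ℝ) 1, ∀ εH ∈ Set.Icc (c * Real.sqrt εg) (Real.sqrt εg),
    ∀ (n : ℕ) (Lg : ℝ) (f : Eu n → ℝ), A1 Lg LH f →
    ∀ (flow : ℝ), (∀ y, flow ≤ f y) →
      ∀ (x₀ : Eu n) (N : ℕ) (x d : ℕ → Eu n) (j : ℕ → ℕ), RWRun f η θ εg εH x₀ N x d j →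
        (∀ k < N, εg < ‖gradient f (x k)‖) →
        (rwEvals N j : ℝ) ≤ C * ((f x₀ - flow) * εg ^ (-(3 / 2) : ℝ) + 1) := by
  obtain ⟨κ, hκ, hlong⟩ := long_step_or_small_gradient hη hθ hL hc
  set J := 1 + θ / (1 - θ) with hJ
  have hJ0 : 0 < J := by
    have : 0 < θ / (1 - θ) := div_pos hθ.1 (by linarith [hθ.2])
    linarith
  set C := 6 * J / (η * κ) with hC
  have hC0 : 0 < C := by positivity
  -- The additive 2 pays for the evaluation at `x₀` and for one last unit step reaching a small
  -- gradient.
  refine ⟨C + 2, by positivity, fun εg hεg εH hεH n Lg f hf flow hflow x₀ N x d j hrun hlarge => ?_⟩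
  rw [rpow_neg_three_halves hεg.1]
  have hh0 := (sqrt_mem_Ioo hεg).1
  set h := Real.sqrt εg with hh
  have hdec : ∀ k < N, η / 6 * ((θ ^ j k) ^ 3 * ‖d k‖ ^ 3) ≤ f (x k) - f (x (k + 1)) :=
    fun k hk => by
      have := (hrun.search k hk).1
      rw [hrun.next k hk]
      simp only [Set.mem_ofPred_eq] at this
      linarith
  have hmono : ∀ k < N, 0 ≤ f (x k) - f (x (k + 1)) := fun k hk =>
    le_trans (by have := hθ.1; positivity) (hdec k hk)
  have hcount : ∀ k < N, κ * h ^ 3 ≤ (θ ^ j k) ^ 4 * ‖d k‖ ^ 3 →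
      (j k : ℝ) + 1 ≤ C * (h ^ 3)⁻¹ * (f (x k) - f (x (k + 1))) := fun k hk hlow => by
    have h1 := trials_mul_steplength_le hθ (j k)
    have hpos : 0 < θ ^ j k := pow_pos hθ.1 _
    have h2 : ((j k : ℝ) + 1) * (κ * h ^ 3) ≤ J * ((θ ^ j k) ^ 3 * ‖d k‖ ^ 3) := by
      calc ((j k : ℝ) + 1) * (κ * h ^ 3) ≤ ((j k : ℝ) + 1) * ((θ ^ j k) ^ 4 * ‖d k‖ ^ 3) := by
            gcongr
        _ = (((j k : ℝ) + 1) * θ ^ j k) * ((θ ^ j k) ^ 3 * ‖d k‖ ^ 3) := by ring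
        _ ≤ J * ((θ ^ j k) ^ 3 * ‖d k‖ ^ 3) := by gcongr
    have h3 : ((j k : ℝ) + 1) * (κ * h ^ 3) ≤ 6 * J / η * (f (x k) - f (x (k + 1))) := by
      refine h2.trans ?_
      have := mul_le_mul_of_nonneg_left (hdec k hk) (by positivity : 0 ≤ 6 * J / η)
      refine le_trans (le_of_eq ?_) this
      field_simp
    rw [← le_div_iff₀ (by positivity)] at h3
    refine h3.trans (le_of_eq ?_)
    rw [hC]
    field_simp
  -- A small gradient at `x (k + 1)` is excluded while `k + 1 < N`, so only the last iteration can
  -- fail to make the step long.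
  have hearly : ∀ k, k + 1 < N → (j k : ℝ) + 1 ≤ C * (h ^ 3)⁻¹ * (f (x k) - f (x (k + 1))) :=
    fun k hk => by
      rcases hlong εg hεg εH hεH n Lg f hf (x k) (d k) (j k) (hrun.direction k (by omega))
        (hrun.search k (by omega)) with h1 | ⟨-, h1⟩
      · exact hcount k (by omega) h1
      · rw [← hrun.next k (by omega)] at h1
        linarith [hlarge (k + 1) hk]
  have hlast : ∀ k < N, (j k : ℝ) + 1 ≤ C * (h ^ 3)⁻¹ * (f (x k) - f (x (k + 1))) + 1 :=
    fun k hk => by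
      rcases hlong εg hεg εH hεH n Lg f hf (x k) (d k) (j k) (hrun.direction k hk)
        (hrun.search k hk) with h1 | ⟨h1, -⟩
      · linarith [hcount k hk h1]
      · rw [h1]
        have := mul_nonneg (by positivity : 0 ≤ C * (h ^ 3)⁻¹) (hmono k hk)
        simpa using this
  have hsum : ∑ k ∈ Finset.range N, ((j k : ℝ) + 1) ≤ C * (h ^ 3)⁻¹ * (f (x 0) - f (x N)) + 1 := by
    cases N with
    | zero => simp
    | succ m =>
      rw [Finset.sum_range_succ]
      have h1 : ∑ k ∈ Finset.range m, ((j k : ℝ) + 1) ≤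
          ∑ k ∈ Finset.range m, C * (h ^ 3)⁻¹ * (f (x k) - f (x (k + 1))) :=
        Finset.sum_le_sum fun k hk => hearly k (by have := Finset.mem_range.1 hk; omega)
      rw [← Finset.mul_sum, Finset.sum_range_sub' (fun k => f (x k))] at h1
      have h2 := hlast m (Nat.lt_succ_self m)
      linarith
  rw [hrun.start] at hsum
  have hI : 0 < (h ^ 3)⁻¹ := by positivity
  have h1 : C * (h ^ 3)⁻¹ * (f x₀ - f (x N)) ≤ C * (h ^ 3)⁻¹ * (f x₀ - flow) := by
    have := hflow (x N); gcongr
  have h2 : 0 ≤ (f x₀ - flow) * (h ^ 3)⁻¹ :=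
    mul_nonneg (by linarith [hflow x₀]) hI.le
  rw [rwEvals]
  push_cast
  nlinarith

end UpperBound

theorem mainTheorem5 (η θ : ℝ) (hη : η ∈ Set.Ioc (0 : ℝ) 3) (hθ : θ ∈ Set.Ioo (0 : ℝ) 1) :
    -- the slow example
    (∃ L a b : ℝ, ∀ εg ∈ Set.Ioo (0 : ℝ) 1, ∀ εH ∈ Set.Ioc (0 : ℝ) (Real.sqrt εg),
      ∃ f : Eu 1 → ℝ, A1 L L f ∧ (∀ y, f y ∈ Set.Icc a b) ∧
        ∃ (x d : ℕ → Eu 1) (j : ℕ → ℕ),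
          RWRun f η θ εg εH 0 ⌈εg ^ (-(3 / 2) : ℝ)⌉₊ x d j ∧
          (∀ k < ⌈εg ^ (-(3 / 2) : ℝ)⌉₊,
            RWNewton f εg εH (x k) (d k) ∧ j k = 0 ∧ εg < ‖gradient f (x k)‖) ∧
          ‖gradient f (x ⌈εg ^ (-(3 / 2) : ℝ)⌉₊)‖ ≤ εg ∧
          RWStops f εg εH (x ⌈εg ^ (-(3 / 2) : ℝ)⌉₊) ∧
          -- the execution is the only one
          (∀ (N : ℕ) (x' d' : ℕ → Eu 1) (j' : ℕ → ℕ), RWRun f η θ εg εH 0 N x' d' j' →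
            N ≤ ⌈εg ^ (-(3 / 2) : ℝ)⌉₊ ∧ (∀ k ≤ N, x' k = x k) ∧
              ∀ k < N, d' k = d k ∧ j' k = j k)) ∧
    -- sharpness: the upper bound of the same order
    (∀ LH : ℝ, 0 ≤ LH → ∀ c ∈ Set.Ioc (0 : ℝ) 1, ∃ C : ℝ, 0 < C ∧
      ∀ εg ∈ Set.Ioo (0 : ℝ) 1, ∀ εH ∈ Set.Icc (c * Real.sqrt εg) (Real.sqrt εg),
      ∀ (n : ℕ) (Lg : ℝ) (f : Eu n → ℝ), A1 Lg LH f →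
        -- every iteration is well defined
        (∀ x, ¬ RWStops f εg εH x → ∃ d, RWDirection f εg εH x d) ∧
        (∀ x d, RWDirection f εg εH x d → ∃ j, RWLineSearch f η θ x d j) ∧
        -- evaluations until the gradient norm is at most `εg`
        ∀ (flow : ℝ), (∀ y, flow ≤ f y) →
          ∀ (x₀ : Eu n) (N : ℕ) (x d : ℕ → Eu n) (j : ℕ → ℕ), RWRun f η θ εg εH x₀ N x d j →
            (∀ k < N, εg < ‖gradient f (x k)‖) →
            (rwEvals N j : ℝ) ≤ C * ((f x₀ - flow) * εg ^ (-(3 / 2) : ℝ) + 1)) ∧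
    -- optimality in order: no method in M.1 does better
    (∀ κrg κrs κl : ℝ, 0 ≤ κrg → κrg < 1 → 0 < κrs → 1 < κl →
      ∃ L a b : ℝ, ∀ ε ∈ Set.Ioo (0 : ℝ) 1, ∀ κs : ℝ, 0 < κs → ∀ A : StepRule 1,
        (∀ f : Eu 1 → ℝ, A1 L L f → (∀ y, f y ∈ Set.Icc a b) →
          A.IsM1On κrg κrs κl κs ε f 0) →
        ∃ f : Eu 1 → ℝ, A1 L L f ∧ (∀ y, f y ∈ Set.Icc a b) ∧
          ∀ k < ⌈ε ^ (-(3 / 2) : ℝ)⌉₊, ε < ‖gradient f (A.iterate f 0 k)‖) ∧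
    -- optimality in order: no method in the CRS class does better
    (∀ σbar ηc κ₁ κ₂ : ℝ, 0 < σbar → 0 < ηc → ηc < 1 → 0 ≤ κ₁ → 0 ≤ κ₂ →
      ∃ L a b c : ℝ, 0 < c ∧ ∀ ε ∈ Set.Ioo (0 : ℝ) 1,
        ∃ f : Eu 1 → ℝ, A1 L L f ∧ (∀ y, f y ∈ Set.Icc a b) ∧
          ∀ (N : ℕ) (x s r : ℕ → Eu 1) (lam σL σU : ℕ → ℝ),
            CRSRun σbar ηc κ₁ κ₂ f 0 N x s r lam σL σU →
            ‖gradient f (x N)‖ ≤ ε → c * ε ^ (-(3 / 2) : ℝ) ≤ N) := by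
  refine ⟨rw_slow_example η θ hη, fun LH hL c hc => ?_,
    fun κrg κrs κl h0 h1 _ hκ => m1_lower_bound h0 h1 hκ,
    fun σbar ηc κ₁ κ₂ _ hη' _ _ _ => crs_lower_bound hη' σbar κ₁ κ₂⟩
  obtain ⟨C, hC, hbound⟩ := rw_upper_bound hη.1 hθ hL hc
  refine ⟨C, hC, fun εg hεg εH hεH n Lg f hf => ⟨fun x hx => ?_, fun x d hd => ?_, ?_⟩⟩
  · exact hf.exists_direction (pos_of_mul_sqrt_le hc.1 hεg.1 hεH.1) hx
  · exact hf.exists_lineSearch hL hη.1 hθ (pos_of_mul_sqrt_le hc.1 hεg.1 hεH.1) hεH.2 hd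
  · exact hbound εg hεg εH hεH n Lg f hf
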